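/- **Setting.** Fix $d\ge 1$. A MOMILP with $d$ objectives is a problem $\min Qx$ s.t. $Ax\ge b$, $x\in\mathbb R^{n_{\mathbb R}}\times\mathbb Z^{n_{\mathbb Z}}$ with rational $Q,A,b$; $X$ is its feasible set and $f(x)=Qx$. Consider a problem $\Pi$ whose instances $I$ (encoded in any way that allows $f(x)$ to be evaluated in time polynomial in $\langle I\rangle+\langle x\rangle$ for rational $x\in X$) are such MOMILPs with $X\ne\emptyset$ and $f(X)\subseteq\mathbb R^d_{\ge0}$. Here $\langle\cdot\rangle$ is the binary encoding length, and running times count bit costs. A set $R\subseteq X$ is an $\alpha$-*convex approximation set* if for every $x\in X$ there is $v\in\mathrm{conv}\{f(x^*):x^*\in R\}$ with $v\le\alpha f(x)$. A *PTAS for the weighted sum scalarization* is an algorithm $\mathsf{WS}$ that, given $I$, $w\in\mathbb Q^d_{\ge0}$ and $\beta\in\mathbb Q_{>0}$, returns a rational $x^*=\mathsf{WS}_{1+\beta}(w)\in X$ with $w^{\mathsf T}f(x^*)\le(1+\beta)\,w^{\mathsf T}f(x)$ for all $x\in X$, in time polynomial in $\langle I\rangle+\langle w\rangle$ for every fixed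 $\beta$; as a standing assumption, for every fixed $\beta$ the returned solutions have encoding length polynomial in $\langle I\rangle$. It is an *FPTAS* if the time is polynomial in $\langle I\rangle+\langle w\rangle+\langle\beta\rangle+\beta^{-1}$; here the returned solutions are assumed to have encoding length polynomial in $\langle I\rangle+\langle\beta\rangle+\beta^{-1}$. A *convex PTAS* for $\Pi$ is an algorithm that, given $I$ and $\varepsilon\in\mathbb Q_{>0}$, returns a finite $(1+\varepsilon)$-convex approximation set, in time polynomial in $\langle I\rangle$ for every fixed $\varepsilon$; a *convex FPTAS* does so in time polynomial in $\langle I\rangle+\langle\varepsilon\rangle+\varepsilon^{-1}$. **Algorithm 1** with oracle $\mathsf{hpO}$-$\mathsf{WS}_{1+\beta}$ and factor $1+\gamma$: start with $R=\{x^{\mathrm{init}}\}$ for a feasible $x^{\mathrm{init}}$ and $F=\emptyset$. While the polyhedron $\mathcal A=\mathrm{conv}\{f(x):x\in R\}+\mathbb R^d_{\ge0}$ has a facet-supporting halfspace $H=\{z:w^{\mathsf T}z\ge c\}\notin F$, choose one arbitrarily and compute $x^*=\mathsf{WS}_{1+\beta}((1+\gamma)w)$; if $(1+\gamma)w^{\mathsf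 T}f(x^*)<c$, add $x^*$ to $R$, otherwise add $H$ to $F$. Return $R$. **Theorem.** Suppose that the weighted sum scalarization of $\Pi$ admits a PTAS (resp. FPTAS) $\mathsf{WS}$. Let $\beta(\varepsilon),\gamma(\varepsilon)\in\mathbb Q_{>0}$ satisfy $(1+\beta)(1+\gamma)\le1+\varepsilon$ for all $\varepsilon\in\mathbb Q_{>0}$ and be computable from $\varepsilon$ (resp. be computable in time polynomial in $\langle\varepsilon\rangle$, with $\beta^{-1}$ and $\gamma^{-1}$ polynomially bounded in $\varepsilon^{-1}$). Then: 1. every terminated execution of Algorithm 1 with $\mathsf{hpO}$-$\mathsf{WS}_{1+\beta}$ and factor $1+\gamma$ returns a $(1+\varepsilon)$-convex approximation set, and every execution makes a number of iterations that is polynomial in $\langle I\rangle$ for every fixed $\varepsilon$ (resp. polynomial in $\langle I\rangle+\langle\varepsilon\rangle+\varepsilon^{-1}$); 2. Algorithm 1 with $\mathsf{hpO}$-$\mathsf{WS}_{1+\beta}$ and factor $1+\gamma$ yields a convex PTAS (resp. convex FPTAS): there is an algorithm that, on every input $(I,\varepsilon)$, returns the result of a terminated execution of Algorithm 1 with these parameters,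 and that is a convex PTAS (resp. convex FPTAS) for $\Pi$. Choices of $\beta,\gamma$ that meet all these conditions exist. -/

import Mathlib

open scoped Pointwise

/-! The machine model: a while-language over rational numbers and pairs in which every elementary
operation is charged the bit lengths of its argument and of its result. All elementary operations
are computable by a Turing machine in time polynomial in that charge, so polynomial time has its
usual meaning. -/

/-- Data: trees whose leaves are rational numbers (or empty). -/
inductive Val : Type
  | nil : Val
  | num (q : ℚ) : Val
  | pair (a b : Val) : Val

/-- The binary encoding length of a datum. -/
def Val.size : Val → ℕ
  | .nil => 1
  | .num q => 1 + q.num.natAbs.size + q.den.size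
  | .pair a b => 1 + a.size + b.size

/-- A list of data as one datum. -/
def Val.ofList : List Val → Val
  | [] => .nil
  | v :: l => .pair v (Val.ofList l)

/-- Encoding of a rational vector, as the list of its entries. -/
def encVec {n : ℕ} (x : Fin n → ℚ) : Val := Val.ofList (List.ofFn fun j => Val.num (x j))

/-- Encoding of a finite list of rational vectors. -/
def encVecs {n : ℕ} (L : List (Fin n → ℚ)) : Val := Val.ofList (L.map encVec)

/-- The elementary operations. -/
inductive Prim : Type
  | id | fst | snd | isNum | isPair | eq | le | add | neg | mul | inv | floor | num | den

open Classical in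
/-- A truth value as a datum: `1` is true, `0` is false. -/
noncomputable def Val.ofProp (p : Prop) : Val := if p then .num 1 else .num 0

/-- The function computed by an elementary operation (`nil` on arguments of the wrong shape). -/
noncomputable def Prim.eval : Prim → Val → Val
  | .id, v => v
  | .fst, .pair a _ => a
  | .snd, .pair _ b => b
  | .isNum, v => Val.ofProp (∃ q, v = .num q)
  | .isPair, v => Val.ofProp (∃ a b, v = .pair a b)
  | .eq, .pair a b => Val.ofProp (a = b)
  | .le, .pair (.num p) (.num q) => Val.ofProp (p ≤ q)
  | .add, .pair (.num p) (.num q) => .num (p + q)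
  | .neg, .num q => .num (-q)
  | .mul, .pair (.num p) (.num q) => .num (p * q)
  | .inv, .num q => .num q⁻¹
  | .floor, .num q => .num (⌊q⌋ : ℤ)
  | .num, .num q => .num (q.num : ℚ)
  | .den, .num q => .num (q.den : ℚ)
  | _, _ => .nil

/-- Programs. A program transforms one datum into another. -/
inductive Prog : Type
  | prim (o : Prim) : Prog
  | const (u : Val) : Prog
  | pair (p q : Prog) : Prog
  | comp (q p : Prog) : Prog
  | cond (c p q : Prog) : Prog
  | loop (c p : Prog) : Prog

/-- `Runs p v u t`: on input `v`, the program `p` halts with output `u` after time `t`.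
`pair p q` computes `(p v, q v)`, `comp q p` computes `q (p v)`, `cond c p q` computes `p v` if
`c v` is true and `q v` otherwise, and `loop c p` repeats `v := p v` while `c v` is true.
The datum `0` is false and every other datum is true. -/
inductive Runs : Prog → Val → Val → ℕ → Prop
  | prim (o : Prim) (v : Val) : Runs (.prim o) v (o.eval v) (1 + v.size + (o.eval v).size)
  | const (u v : Val) : Runs (.const u) v u (1 + v.size + u.size)
  | pair {p q : Prog} {v a b : Val} {s t : ℕ} :
      Runs p v a s → Runs q v b t → Runs (.pair p q) v (.pair a b) (s + t + 1)
  | comp {p q : Prog} {v a b : Val} {s t : ℕ} :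
      Runs p v a s → Runs q a b t → Runs (.comp q p) v b (s + t + 1)
  | cond_true {c p q : Prog} {v a b : Val} {s t : ℕ} :
      Runs c v a s → a ≠ .num 0 → Runs p v b t → Runs (.cond c p q) v b (s + t + 1)
  | cond_false {c p q : Prog} {v b : Val} {s t : ℕ} :
      Runs c v (.num 0) s → Runs q v b t → Runs (.cond c p q) v b (s + t + 1)
  | loop_exit {c p : Prog} {v : Val} {s : ℕ} :
      Runs c v (.num 0) s → Runs (.loop c p) v v (s + 1)
  | loop_step {c p : Prog} {v a v₁ u : Val} {r s t : ℕ} :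
      Runs c v a r → a ≠ .num 0 → Runs p v v₁ s → Runs (.loop c p) v₁ u t →
      Runs (.loop c p) v u (r + s + t + 1)

/-! Multi-objective mixed-integer linear programs. -/

/-- The program `min Q x` subject to `A x ≥ b`, `x ∈ ℝ^nR × ℤ^nZ`, with `d` objectives. -/
structure MOMILP (d : ℕ) where
  m : ℕ
  nR : ℕ
  nZ : ℕ
  Q : Matrix (Fin d) (Fin (nR + nZ)) ℚ
  A : Matrix (Fin m) (Fin (nR + nZ)) ℚ
  b : Fin m → ℚ

namespace MOMILP

section

variable {d : ℕ} (M : MOMILP d)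

/-- The set of feasible solutions. -/
def X : Set (Fin (M.nR + M.nZ) → ℝ) :=
  {x | (∀ i, (M.b i : ℝ) ≤ ∑ j, (M.A i j : ℝ) * x j) ∧
    ∀ j : Fin M.nZ, ∃ k : ℤ, x (Fin.natAdd M.nR j) = k}

/-- The objective function. -/
def f (x : Fin (M.nR + M.nZ) → ℝ) : Fin d → ℝ := fun i => ∑ j, (M.Q i j : ℝ) * x j

/-- Rational vectors of variables: the candidates for solutions that an algorithm can return. -/
abbrev Sol : Type := Fin (M.nR + M.nZ) → ℚ

/-- A rational vector, seen in real space. -/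
def real (x : M.Sol) : Fin (M.nR + M.nZ) → ℝ := fun j => (x j : ℝ)

/-- The image of a rational vector, as a rational vector. -/
def ratImage (x : M.Sol) : Fin d → ℚ := fun i => ∑ j, M.Q i j * x j

/-- The images of a set of solutions. -/
def images (R : Set M.Sol) : Set (Fin d → ℝ) := (fun x => M.f (M.real x)) '' R

/-- `R` is an `α`-convex approximation set. -/
def IsConvexApprox (α : ℝ) (R : Set M.Sol) : Prop :=
  (∀ x ∈ R, M.real x ∈ M.X) ∧
  ∀ x ∈ M.X, ∃ v ∈ convexHull ℝ (M.images R), v ≤ α • M.f x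

/-- The inner approximation polyhedron of a set of solutions. -/
def innerApprox (R : Set M.Sol) : Set (Fin d → ℝ) :=
  convexHull ℝ (M.images R) + {z | 0 ≤ z}

end

end MOMILP

/-- The halfspace `{z : wᵀ z ≥ c}`. -/
def halfspace {d : ℕ} (w : Fin d → ℝ) (c : ℝ) : Set (Fin d → ℝ) := {z | c ≤ ∑ i, w i * z i}

/-- The boundary hyperplane `{z : wᵀ z = c}`. -/
def hyperplane {d : ℕ} (w : Fin d → ℝ) (c : ℝ) : Set (Fin d → ℝ) := {z | ∑ i, w i * z i = c}

/-- The dimension of a set: that of its affine hull. -/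
noncomputable def affDim {d : ℕ} (S : Set (Fin d → ℝ)) : ℕ :=
  Module.finrank ℝ (affineSpan ℝ S).direction

/-- The set of facet-supporting halfspaces of a polyhedron: the valid halfspaces whose boundary
meets the polyhedron in a nonempty set of dimension one less than the polyhedron. -/
def facetHalfspaces {d : ℕ} (P : Set (Fin d → ℝ)) : Set (Set (Fin d → ℝ)) :=
  {H | ∃ (w : Fin d → ℝ) (c : ℝ), w ≠ 0 ∧ H = halfspace w c ∧ P ⊆ H ∧
    (P ∩ hyperplane w c).Nonempty ∧ affDim (P ∩ hyperplane w c) + 1 = affDim P}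

/-- A multi-objective problem with `d` objectives whose instances are MOMILPs. Instances may be
encoded in any way (`inst` is the set of codes and `milp` tells which MOMILP a code describes), as
long as the objective function can be evaluated in polynomial time. Feasible sets are nonempty
and images are nonnegative. -/
structure Problem (d : ℕ) where
  inst : Set Val
  milp : Val → MOMILP d
  nonempty : ∀ I ∈ inst, (milp I).X.Nonempty
  nonneg : ∀ I ∈ inst, ∀ x ∈ (milp I).X, 0 ≤ (milp I).f x
  evaluable : ∃ (E : Prog) (p : Polynomial ℕ), ∀ I ∈ inst, ∀ x : (milp I).Sol,
    (milp I).real x ∈ (milp I).X →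
      ∃ t, Runs E (.pair I (encVec x)) (encVec ((milp I).ratImage x)) t ∧
        t ≤ p.eval (I.size + (encVec x).size)

section

variable {d : ℕ}

/-- The input of a program for the weighted sum scalarization: instance, weight, accuracy. -/
def wsInput (I : Val) (w : Fin d → ℚ) (δ : ℚ) : Val := .pair I (.pair (encVec w) (.num δ))

/-- `x` is an `α`-approximate solution of the weighted sum scalarization with weight `w`. -/
def IsApproxWS (M : MOMILP d) (w : Fin d → ℚ) (α : ℝ) (x : M.Sol) : Prop :=
  M.real x ∈ M.X ∧
  ∀ x' ∈ M.X, ∑ i, (w i : ℝ) * M.f (M.real x) i ≤ α * ∑ i, (w i : ℝ) * M.f x' i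

/-- `WS` is a polynomial-time approximation scheme for the weighted sum scalarization. -/
def IsWSPTAS (Pb : Problem d) (WS : Prog) : Prop :=
  ∀ δ : ℚ, 0 < δ → ∃ p : Polynomial ℕ, ∀ I ∈ Pb.inst, ∀ w : Fin d → ℚ, 0 ≤ w →
    ∃ (x : (Pb.milp I).Sol) (t : ℕ), Runs WS (wsInput I w δ) (encVec x) t ∧
      IsApproxWS (Pb.milp I) w (1 + δ) x ∧ t ≤ p.eval (I.size + (encVec w).size)

/-- `WS` is a fully polynomial-time approximation scheme for the weighted sum scalarization. -/
def IsWSFPTAS (Pb : Problem d) (WS : Prog) : Prop :=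
  ∃ p : Polynomial ℕ, ∀ δ : ℚ, 0 < δ → ∀ I ∈ Pb.inst, ∀ w : Fin d → ℚ, 0 ≤ w →
    ∃ (x : (Pb.milp I).Sol) (t : ℕ), Runs WS (wsInput I w δ) (encVec x) t ∧
      IsApproxWS (Pb.milp I) w (1 + δ) x ∧
      t ≤ p.eval (I.size + (encVec w).size + (Val.num δ).size + ⌈δ⁻¹⌉₊)

/-- For every fixed accuracy, the solutions returned by `WS` have encoding length polynomial in
that of the instance (independently of the weight). -/
def HasShortSolutions (Pb : Problem d) (WS : Prog) : Prop :=
  ∀ δ : ℚ, 0 < δ → ∃ p : Polynomial ℕ, ∀ I ∈ Pb.inst, ∀ w : Fin d → ℚ, 0 ≤ w →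
    ∀ (x : (Pb.milp I).Sol) (t : ℕ), Runs WS (wsInput I w δ) (encVec x) t →
      (encVec x).size ≤ p.eval I.size

/-- As `HasShortSolutions`, with one polynomial in the encoding lengths of instance and accuracy
and the inverse accuracy. -/
def HasUniformlyShortSolutions (Pb : Problem d) (WS : Prog) : Prop :=
  ∃ p : Polynomial ℕ, ∀ δ : ℚ, 0 < δ → ∀ I ∈ Pb.inst, ∀ w : Fin d → ℚ, 0 ≤ w →
    ∀ (x : (Pb.milp I).Sol) (t : ℕ), Runs WS (wsInput I w δ) (encVec x) t →
      (encVec x).size ≤ p.eval (I.size + (Val.num δ).size + ⌈δ⁻¹⌉₊)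

/-- `P` is a multi-objective convex polynomial-time approximation scheme. -/
def IsConvexPTAS (Pb : Problem d) (P : Prog) : Prop :=
  ∀ ε : ℚ, 0 < ε → ∃ p : Polynomial ℕ, ∀ I ∈ Pb.inst,
    ∃ (L : List (Pb.milp I).Sol) (t : ℕ), Runs P (.pair I (.num ε)) (encVecs L) t ∧
      (Pb.milp I).IsConvexApprox (1 + ε) {x | x ∈ L} ∧ t ≤ p.eval I.size

/-- `P` is a multi-objective convex fully polynomial-time approximation scheme. -/
def IsConvexFPTAS (Pb : Problem d) (P : Prog) : Prop :=
  ∃ p : Polynomial ℕ, ∀ ε : ℚ, 0 < ε → ∀ I ∈ Pb.inst,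
    ∃ (L : List (Pb.milp I).Sol) (t : ℕ), Runs P (.pair I (.num ε)) (encVecs L) t ∧
      (Pb.milp I).IsConvexApprox (1 + ε) {x | x ∈ L} ∧
      t ≤ p.eval (I.size + (Val.num ε).size + ⌈ε⁻¹⌉₊)

/-! The inner approximation algorithm. -/

/-- A plane separating oracle, as the relation between the halfspace `{z : wᵀ z ≥ c}` it is called
with and its answer: `none` stands for "inside" and `some x` for "not inside" with solution `x`. -/
abbrev PlaneOracle (M : MOMILP d) : Type := (Fin d → ℚ) → ℚ → Option M.Sol → Prop

/-- The plane separating oracle built on the weighted sum program `WS` called with accuracy `β`: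
compute `x` for the weight `w`; answer "inside" if `wᵀ f(x) ≥ c`, else "not inside" with `x`. -/
inductive hpOWS (Pb : Problem d) (WS : Prog) (I : Val) (β : ℚ) : PlaneOracle (Pb.milp I)
  | inside {w : Fin d → ℚ} {c : ℚ} {x : (Pb.milp I).Sol} {t : ℕ} :
      Runs WS (wsInput I w β) (encVec x) t → c ≤ ∑ i, w i * (Pb.milp I).ratImage x i →
      hpOWS Pb WS I β w c none
  | not_inside {w : Fin d → ℚ} {c : ℚ} {x : (Pb.milp I).Sol} {t : ℕ} :
      Runs WS (wsInput I w β) (encVec x) t → ∑ i, w i * (Pb.milp I).ratImage x i < c →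
      hpOWS Pb WS I β w c (some x)

/-- `InnerRun M O α k R F`: the inner approximation algorithm with oracle `O` and factor `α`,
started from an arbitrary feasible solution, can have `R` as its set of solutions and `F` as its
set of finished halfspaces after `k` iterations. In every iteration an arbitrary facet-supporting
halfspace `{z : wᵀ z ≥ c}` outside `F` is chosen, and the oracle is called with
`{z : α wᵀ z ≥ c}`. -/
inductive InnerRun (M : MOMILP d) (O : PlaneOracle M) (α : ℚ) :
    ℕ → Set M.Sol → Set (Set (Fin d → ℝ)) → Prop
  | init {x : M.Sol} : M.real x ∈ M.X → InnerRun M O α 0 {x} ∅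
  | not_inside {k : ℕ} {R : Set M.Sol} {F : Set (Set (Fin d → ℝ))}
      {w : Fin d → ℚ} {c : ℚ} {x : M.Sol} :
      InnerRun M O α k R F →
      halfspace (fun i => (w i : ℝ)) c ∈ facetHalfspaces (M.innerApprox R) \ F →
      O (α • w) c (some x) → InnerRun M O α (k + 1) (insert x R) F
  | inside {k : ℕ} {R : Set M.Sol} {F : Set (Set (Fin d → ℝ))}
      {w : Fin d → ℚ} {c : ℚ} :
      InnerRun M O α k R F →
      halfspace (fun i => (w i : ℝ)) c ∈ facetHalfspaces (M.innerApprox R) \ F →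
      O (α • w) c none →
      InnerRun M O α (k + 1) R (insert (halfspace (fun i => (w i : ℝ)) c) F)

/-- `R` is the result of some terminated execution of the inner approximation algorithm. -/
def InnerOutput (M : MOMILP d) (O : PlaneOracle M) (α : ℚ) (R : Set M.Sol) : Prop :=
  ∃ k F, InnerRun M O α k R F ∧ facetHalfspaces (M.innerApprox R) \ F = ∅

/-- The program `P` carries out the inner approximation algorithm with the weighted sum oracle of
accuracy `β ε` and with factor `1 + γ ε`, on every instance and for every `ε`. -/
def Implements (Pb : Problem d) (WS : Prog) (β γ : ℚ → ℚ) (P : Prog) : Prop :=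
  ∀ ε : ℚ, 0 < ε → ∀ I ∈ Pb.inst, ∃ (L : List (Pb.milp I).Sol) (t : ℕ),
    Runs P (.pair I (.num ε)) (encVecs L) t ∧
      InnerOutput (Pb.milp I) (hpOWS Pb WS I (β ε)) (1 + γ ε) {x | x ∈ L}

/-- Every terminated execution yields a `(1 + ε)`-convex approximation set, whatever initial
solution and halfspaces were chosen. -/
def AlwaysCorrect (Pb : Problem d) (WS : Prog) (β γ : ℚ → ℚ) : Prop :=
  ∀ ε : ℚ, 0 < ε → ∀ I ∈ Pb.inst, ∀ R : Set (Pb.milp I).Sol,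
    InnerOutput (Pb.milp I) (hpOWS Pb WS I (β ε)) (1 + γ ε) R →
      (Pb.milp I).IsConvexApprox (1 + ε) R

/-- For every fixed `ε`, every execution of the inner approximation algorithm (terminated or not)
has made a number of iterations that is polynomial in the encoding length of the instance. -/
def AlwaysPolyIter (Pb : Problem d) (WS : Prog) (β γ : ℚ → ℚ) : Prop :=
  ∀ ε : ℚ, 0 < ε → ∃ p : Polynomial ℕ, ∀ I ∈ Pb.inst,
    ∀ (k : ℕ) (R : Set (Pb.milp I).Sol) (F : Set (Set (Fin d → ℝ))),
      InnerRun (Pb.milp I) (hpOWS Pb WS I (β ε)) (1 + γ ε) k R F → k ≤ p.eval I.size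

/-- As `AlwaysPolyIter`, with one polynomial for all `ε`. -/
def AlwaysUniformPolyIter (Pb : Problem d) (WS : Prog) (β γ : ℚ → ℚ) : Prop :=
  ∃ p : Polynomial ℕ, ∀ ε : ℚ, 0 < ε → ∀ I ∈ Pb.inst,
    ∀ (k : ℕ) (R : Set (Pb.milp I).Sol) (F : Set (Set (Fin d → ℝ))),
      InnerRun (Pb.milp I) (hpOWS Pb WS I (β ε)) (1 + γ ε) k R F →
        k ≤ p.eval (I.size + (Val.num ε).size + ⌈ε⁻¹⌉₊)

end

/-- `β` and `γ` are positive with `(1 + β)(1 + γ) ≤ 1 + ε`. -/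
def IsSplit (β γ : ℚ → ℚ) : Prop :=
  ∀ ε : ℚ, 0 < ε → 0 < β ε ∧ 0 < γ ε ∧ (1 + β ε) * (1 + γ ε) ≤ 1 + ε

/-- `β` and `γ` can be computed from `ε`. -/
def IsComputableSplit (β γ : ℚ → ℚ) : Prop :=
  IsSplit β γ ∧ ∃ S : Prog, ∀ ε : ℚ, 0 < ε →
    ∃ t, Runs S (.num ε) (.pair (.num (β ε)) (.num (γ ε))) t

/-- `β` and `γ` can be computed from `ε` in polynomial time (so that their encoding lengths are
polynomial in that of `ε`), and their inverses are polynomially bounded in the inverse of `ε`. -/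
def IsPolySplit (β γ : ℚ → ℚ) : Prop :=
  IsSplit β γ ∧ ∃ (S : Prog) (p : Polynomial ℕ), ∀ ε : ℚ, 0 < ε →
    (∃ t, Runs S (.num ε) (.pair (.num (β ε)) (.num (γ ε))) t ∧ t ≤ p.eval (Val.num ε).size) ∧
    ⌈(β ε)⁻¹⌉₊ ≤ p.eval ⌈ε⁻¹⌉₊ ∧ ⌈(γ ε)⁻¹⌉₊ ≤ p.eval ⌈ε⁻¹⌉₊

/-!
The proof has a geometric, a counting and a computational part.

**Correctness.** The polyhedron `conv Y + ℝ^d_{≥0}` of a finite nonempty set `Y` is the intersection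
of its facet-supporting halfspaces (`mem_upperHull_of_forall_facet`). If a halfspace `wᵀ z ≥ c` has
been finished, then `c ≤ (1 + γ)(1 + β) wᵀ f(x)` for all feasible `x`. So when all facets are
finished, `(1 + γ)(1 + β) f(x)` lies in every facet-supporting halfspace, hence in the polyhedron,
and this is what a convex approximation set requires.

**Number of iterations.** A solution is only added if some facet normal `w ≥ 0` separates its image,
scaled by `1 + γ`, from all earlier ones. Hence each earlier image exceeds each later one by a factor
of more than `1 + γ` in some objective, and no two images lie in the same cell of a grid with ratio
`1 + γ`. The entries of the images have encoding length polynomial in the input, because the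
solutions do and the objectives are computed in polynomial time (the arbitrary initial solution is
the one exception, and counts as one more solution); so the grid has polynomially many cells, the number `d` of objectives being fixed (`List.length_le_of_pairwise_exceeds`). Facets are
determined by `d` generators (points of `Y` and axis directions), so there are polynomially many
candidates for finished halfspaces (`InnerRun.length_le`).

**The program.** Points `y` are homogenized to `(1, y)` and axis directions to `(0, e_i)`. A halfspace
becomes a linear form on `ℝ^{d+1}`, and the facets are the normalized forms that are nonnegative on
all generators and arise as the generalized cross product of `d` of them
(`facetHalfspaces_upperHull`). They can be enumerated in polynomial time (`polyTime_facetList`):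
running through all `d`-tuples of a list and expanding a determinant of fixed size are polynomial.
Each linear form has encoding length bounded in terms of `d` images, so the data do not grow from
one iteration to the next, and the iteration bound makes the program polynomial (`exists_program`).
The cases of fixed and of variable accuracy differ only in the measure in which "polynomial" is
understood; `IsRegime` treats them together.
-/

/-! ### Programs and their running times -/

theorem Runs.deterministic {P : Prog} {v u u' : Val} {t t' : ℕ} (h : Runs P v u t)
    (h' : Runs P v u' t') : u = u' := by
  induction h generalizing u' t' with
  | prim o v => cases h'; rfl
  | const u v => cases h'; rfl
  | pair _ _ ih₁ ih₂ => cases h' with | pair h₁ h₂ => rw [ih₁ h₁, ih₂ h₂]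
  | comp _ _ ih₁ ih₂ =>
    cases h' with
    | comp h₁ h₂ => cases ih₁ h₁; exact ih₂ h₂
  | cond_true _ ha _ ih₁ ih₂ =>
    cases h' with
    | cond_true h₁ _ h₂ => exact ih₂ h₂
    | cond_false h₁ h₂ => exact absurd (ih₁ h₁) ha
  | cond_false _ _ ih₁ ih₂ =>
    cases h' with
    | cond_true h₁ ha h₂ => exact absurd (ih₁ h₁).symm ha
    | cond_false h₁ h₂ => exact ih₂ h₂
  | loop_exit _ ih =>
    cases h' with
    | loop_exit h₁ => rfl
    | loop_step h₁ ha _ _ => exact absurd (ih h₁).symm ha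
  | loop_step _ ha _ _ ih₁ ih₂ ih₃ =>
    cases h' with
    | loop_exit h₁ => exact absurd (ih₁ h₁) ha
    | loop_step h₁ _ h₂ h₃ => cases ih₂ h₂; exact ih₃ h₃

/-- Every step is charged for the data it handles, so the running time bounds the lengths of the
input and of the output. -/
theorem Runs.size_le {P : Prog} {v u : Val} {t : ℕ} (h : Runs P v u t) :
    v.size ≤ t ∧ u.size ≤ t := by
  induction h <;> (try simp only [Val.size] at *) <;> omega

/-- On input `v`, the program `P` halts with output `u` within time `b`. -/
def Prog.RunsWithin (P : Prog) (v u : Val) (b : ℕ) : Prop := ∃ t, Runs P v u t ∧ t ≤ b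

namespace Prog.RunsWithin

variable {P Q C : Prog} {v u a : Val} {b b' : ℕ}

theorem mono (h : P.RunsWithin v u b) (hb : b ≤ b') : P.RunsWithin v u b' :=
  let ⟨t, ht, htb⟩ := h; ⟨t, ht, htb.trans hb⟩

theorem size_le (h : P.RunsWithin v u b) : u.size ≤ b :=
  let ⟨_, ht, htb⟩ := h; ht.size_le.2.trans htb

theorem pair (h : P.RunsWithin v u b) (h' : Q.RunsWithin v a b') :
    (Prog.pair P Q).RunsWithin v (.pair u a) (b + b' + 1) :=
  let ⟨_, ht, htb⟩ := h; let ⟨_, ht', htb'⟩ := h'; ⟨_, .pair ht ht', by omega⟩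

theorem comp (h' : Q.RunsWithin u a b') (h : P.RunsWithin v u b) :
    (Prog.comp Q P).RunsWithin v a (b + b' + 1) :=
  let ⟨_, ht, htb⟩ := h; let ⟨_, ht', htb'⟩ := h'; ⟨_, .comp ht ht', by omega⟩

theorem cond_true (hC : C.RunsWithin v a b) (ha : a ≠ .num 0) (h : P.RunsWithin v u b') :
    (Prog.cond C P Q).RunsWithin v u (b + b' + 1) :=
  let ⟨_, ht, htb⟩ := hC; let ⟨_, ht', htb'⟩ := h; ⟨_, .cond_true ht ha ht', by omega⟩

theorem cond_false (hC : C.RunsWithin v (.num 0) b) (h : Q.RunsWithin v u b') :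
    (Prog.cond C P Q).RunsWithin v u (b + b' + 1) :=
  let ⟨_, ht, htb⟩ := hC; let ⟨_, ht', htb'⟩ := h; ⟨_, .cond_false ht ht', by omega⟩

/-- A loop terminates if an invariant bounds the number `k` of its iterations so far. -/
theorem loop {T K : ℕ} {Inv Done : ℕ → Val → Prop} (hK : ∀ k v, Inv k v → k ≤ K)
    (hstep : ∀ k v, Inv k v → (Done k v ∧ C.RunsWithin v (.num 0) T) ∨
      ∃ a w, a ≠ .num 0 ∧ C.RunsWithin v a T ∧ P.RunsWithin v w T ∧ Inv (k + 1) w)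
    {v : Val} (hv : Inv 0 v) :
    ∃ k w, Done k w ∧ (Prog.loop C P).RunsWithin v w ((K + 1) * (2 * T + 1)) := by
  have key : ∀ n k v, Inv k v → K + 1 ≤ k + n →
      ∃ j w, Done j w ∧ (Prog.loop C P).RunsWithin v w (n * (2 * T + 1)) := by
    intro n
    induction n with
    | zero =>
      intro k v hv hn
      have := hK k v hv
      omega
    | succ n ih =>
      intro k v hv hn
      rcases hstep k v hv with ⟨hd, t, ht, htT⟩ | ⟨a, w, ha, ⟨r, hr, hrT⟩, ⟨q, hq, hqT⟩, hw⟩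
      · refine ⟨k, v, hd, _, .loop_exit ht, ?_⟩
        rw [Nat.succ_mul]
        omega
      · obtain ⟨j, u, hu, t, ht, htT⟩ := ih (k + 1) w hw (by omega)
        refine ⟨j, u, hu, _, .loop_step hr ha hq ht, ?_⟩
        rw [Nat.succ_mul]
        omega
  exact key (K + 1) 0 v hv (by omega)

end Prog.RunsWithin

theorem Polynomial.eval_le_eval_nat (p : Polynomial ℕ) {m n : ℕ} (h : m ≤ n) :
    p.eval m ≤ p.eval n := by
  simp only [Polynomial.eval_eq_sum, Polynomial.sum]
  gcongr

/-! ### Polynomial-time functions between encoded types -/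

/-- A type whose elements are represented, without ambiguity, by data. -/
class Enc (α : Type) where
  enc : α → Val
  enc_injective : Function.Injective enc

open Enc

/-- The encoding length of an element of an encoded type. -/
def encSize {α : Type} [Enc α] (a : α) : ℕ := (enc a).size

theorem Val.ofList_injective : Function.Injective Val.ofList := by
  intro l l' h
  induction l generalizing l' with
  | nil => cases l' <;> simp_all [Val.ofList]
  | cons a l ih =>
    cases l' with
    | nil => simp [Val.ofList] at h
    | cons a' l' =>
      simp only [Val.ofList, Val.pair.injEq] at h
      rw [h.1, ih h.2]

instance : Enc Val := ⟨id, Function.injective_id⟩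

instance : Enc ℚ := ⟨.num, fun _ _ h => by simpa using h⟩

instance : Enc Bool := ⟨fun b => .num (if b then 1 else 0), fun a b h => by
  cases a <;> cases b <;> simp_all⟩

instance {α β : Type} [Enc α] [Enc β] : Enc (α × β) :=
  ⟨fun x => .pair (enc x.1) (enc x.2), fun x y h => by
    simp only [Val.pair.injEq] at h
    exact Prod.ext (enc_injective h.1) (enc_injective h.2)⟩

instance {α : Type} [Enc α] : Enc (List α) :=
  ⟨fun l => Val.ofList (l.map enc), fun _ _ h =>
    (List.map_injective_iff.2 enc_injective) (Val.ofList_injective h)⟩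

instance {α : Type} [Enc α] {n : ℕ} : Enc (Fin n → α) :=
  ⟨fun x => Val.ofList (List.ofFn fun j => enc (x j)), fun _ _ h => by
    have := List.ofFn_injective (Val.ofList_injective h)
    exact funext fun j => enc_injective (congrFun this j)⟩

theorem encVec_injective {n : ℕ} : Function.Injective (encVec (n := n)) :=
  enc_injective (α := Fin n → ℚ)

section

variable {α β γ σ : Type} [Enc α] [Enc β] [Enc γ] [Enc σ]

theorem encSize_prod (x : α × β) : encSize x = 1 + encSize x.1 + encSize x.2 := rfl

theorem encSize_mk (a : α) (b : β) : encSize (a, b) = 1 + encSize a + encSize b := rfl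

theorem encSize_nil : encSize ([] : List α) = 1 := rfl

theorem encSize_cons (a : α) (l : List α) : encSize (a :: l) = 1 + encSize a + encSize l := rfl

theorem encSize_append (l l' : List α) : encSize (l ++ l') + 1 = encSize l + encSize l' := by
  induction l with
  | nil => simp [encSize_nil]; omega
  | cons a l ih => simp only [List.cons_append, encSize_cons]; omega

theorem encSize_le_of_mem {a : α} {l : List α} (h : a ∈ l) : encSize a ≤ encSize l := by
  induction l with
  | nil => simp at h
  | cons b l ih =>
    rw [encSize_cons]
    rcases List.mem_cons.1 h with rfl | h
    · omega
    · have := ih h; omega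

theorem length_lt_encSize (l : List α) : l.length < encSize l := by
  induction l with
  | nil => simp [encSize_nil]
  | cons b l ih => rw [encSize_cons, List.length_cons]; omega

theorem encSize_le_of_forall_le {l : List α} {B : ℕ} (h : ∀ a ∈ l, encSize a ≤ B) :
    encSize l ≤ 1 + l.length * (B + 1) := by
  induction l with
  | nil => simp [encSize_nil]
  | cons b l ih =>
    have h1 := h b (by simp)
    have h2 := ih fun a ha => h a (by simp [ha])
    rw [encSize_cons, List.length_cons, Nat.succ_mul]
    omega

theorem enc_vecCons {n : ℕ} (a : α) (x : Fin n → α) :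
    enc (Fin.cons a x : Fin (n + 1) → α) = .pair (enc a) (enc x) := by
  change Val.ofList (List.ofFn _) = .pair _ (Val.ofList (List.ofFn _))
  rw [List.ofFn_succ]
  simp [Val.ofList]

/-- `f` is computed by a program in time polynomial in the length of the argument. -/
def PolyTime (f : α → β) : Prop :=
  ∃ (P : Prog) (p : Polynomial ℕ), ∀ a, P.RunsWithin (enc a) (enc (f a)) (p.eval (encSize a))

namespace PolyTime

theorem encSize_le {f : α → β} (hf : PolyTime f) :
    ∃ q : Polynomial ℕ, ∀ a, encSize (f a) ≤ q.eval (encSize a) :=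
  let ⟨_, p, h⟩ := hf; ⟨p, fun a => (h a).size_le⟩

theorem of_prim {f : α → β} (o : Prim) (h : ∀ a, o.eval (enc a) = enc (f a)) (q : Polynomial ℕ)
    (hq : ∀ a, encSize (f a) ≤ q.eval (encSize a)) : PolyTime f := by
  refine ⟨.prim o, 1 + Polynomial.X + q, fun a => ⟨1 + encSize a + encSize (f a), ?_, ?_⟩⟩
  · have := Runs.prim o (enc a)
    rwa [h a] at this
  · have := hq a
    simp
    omega

theorem id : PolyTime (fun a : α => a) :=
  of_prim .id (fun _ => by simp [Prim.eval]) .X fun a => by simp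

theorem const (b : β) : PolyTime (fun _ : α => b) :=
  ⟨.const (enc b), 1 + Polynomial.X + Polynomial.C (encSize b), fun a =>
    ⟨_, .const _ _, by simp [encSize]⟩⟩

theorem comp {g : β → γ} {f : α → β} (hg : PolyTime g) (hf : PolyTime f) :
    PolyTime (fun a => g (f a)) := by
  obtain ⟨P, p, hP⟩ := hf
  obtain ⟨Q, q, hQ⟩ := hg
  refine ⟨.comp Q P, p + q.comp p + 1, fun a => ((hQ (f a)).comp (hP a)).mono ?_⟩
  have := q.eval_le_eval_nat (hP a).size_le
  simp only [Polynomial.eval_add, Polynomial.eval_comp, Polynomial.eval_one, encSize] at *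
  omega

theorem prodMk {f : α → β} {g : α → γ} (hf : PolyTime f) (hg : PolyTime g) :
    PolyTime (fun a => (f a, g a)) := by
  obtain ⟨P, p, hP⟩ := hf
  obtain ⟨Q, q, hQ⟩ := hg
  refine ⟨.pair P Q, p + q + 1, fun a => ((hP a).pair (hQ a)).mono (by simp)⟩

theorem fst {f : α → β × γ} (hf : PolyTime f) : PolyTime (fun a => (f a).1) :=
  comp (of_prim (f := fun x : β × γ => x.1) .fst (fun _ => rfl) .X fun a => by
    simp [encSize_prod]; omega) hf

theorem snd {f : α → β × γ} (hf : PolyTime f) : PolyTime (fun a => (f a).2) :=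
  comp (of_prim (f := fun x : β × γ => x.2) .snd (fun _ => rfl) .X fun a => by
    simp [encSize_prod]) hf

theorem ite {c : α → Bool} {f g : α → β} (hc : PolyTime c) (hf : PolyTime f) (hg : PolyTime g) :
    PolyTime (fun a => if c a then f a else g a) := by
  obtain ⟨C, r, hC⟩ := hc
  obtain ⟨P, p, hP⟩ := hf
  obtain ⟨Q, q, hQ⟩ := hg
  refine ⟨.cond C P Q, r + p + q + 1, fun a => ?_⟩
  have hCa := hC a
  change Prog.RunsWithin _ _ (enc (if c a then f a else g a)) _
  cases h : c a with
  | true =>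
    rw [h] at hCa
    rw [if_pos rfl]
    exact (Prog.RunsWithin.cond_true hCa (by simp [enc]) (hP a)).mono (by simp)
  | false =>
    rw [h] at hCa
    rw [if_neg (by simp)]
    exact (Prog.RunsWithin.cond_false hCa (hQ a)).mono (by simp)

theorem encSize_bool_le (b : Bool) : encSize b ≤ 3 := by
  cases b <;> simp [encSize, enc, Val.size]

theorem not {c : α → Bool} (hc : PolyTime c) : PolyTime (fun a => !c a) := by
  have := ite hc (const false) (const true)
  refine (funext fun a => ?_ : (fun a => if c a then false else true) = fun a => !c a) ▸ this
  cases c a <;> rfl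

theorem and {c e : α → Bool} (hc : PolyTime c) (he : PolyTime e) :
    PolyTime (fun a => c a && e a) := by
  have := ite hc he (const false)
  refine (funext fun a => ?_ : (fun a => if c a then e a else false) = fun a => c a && e a) ▸ this
  cases c a <;> rfl

theorem ofProp_eq_enc_decide (p : Prop) [Decidable p] : Val.ofProp p = enc (decide p) := by
  by_cases h : p <;> simp [Val.ofProp, h, enc]

theorem eq [DecidableEq β] {f g : α → β} (hf : PolyTime f) (hg : PolyTime g) :
    PolyTime (fun a => decide (f a = g a)) :=
  comp (of_prim (f := fun x : β × β => decide (x.1 = x.2)) .eq (fun x => by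
    rw [← ofProp_eq_enc_decide, ← (enc_injective (α := β)).eq_iff]; rfl) 3 fun a => by
      simpa using encSize_bool_le _) (prodMk hf hg)

end PolyTime

/-! ### Rational arithmetic -/

theorem Nat.size_mul_le (a b : ℕ) : (a * b).size ≤ a.size + b.size := by
  rw [Nat.size_le, pow_add]
  exact Nat.mul_lt_mul'' (Nat.lt_size_self a) (Nat.lt_size_self b)

theorem Nat.size_add_le (a b : ℕ) : (a + b).size ≤ a.size + b.size + 1 := by
  rw [Nat.size_le, pow_succ, pow_add]
  have ha := Nat.lt_size_self a
  have hb := Nat.lt_size_self b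
  have ha' := Nat.one_le_two_pow (n := a.size)
  have hb' := Nat.one_le_two_pow (n := b.size)
  nlinarith

theorem Rat.size_divInt_le (a : ℤ) {b : ℤ} (hb : b ≠ 0) :
    (Rat.divInt a b).num.natAbs.size ≤ a.natAbs.size ∧
      (Rat.divInt a b).den.size ≤ b.natAbs.size := by
  constructor
  · rcases eq_or_ne a 0 with rfl | ha
    · simp
    · exact Nat.size_le_size (Int.natAbs_le_of_dvd_ne_zero (Rat.num_dvd a hb) ha)
  · have h := Rat.den_dvd a b
    exact Nat.size_le_size (Int.natAbs_le_of_dvd_ne_zero h hb)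

theorem encSize_rat (q : ℚ) : encSize q = 1 + q.num.natAbs.size + q.den.size := rfl

theorem encSize_mul_le (p q : ℚ) : encSize (p * q) ≤ encSize p + encSize q := by
  have h : p * q = Rat.divInt (p.num * q.num) ((p.den * q.den : ℕ) : ℤ) := by
    rw [Rat.mul_eq_mkRat, Rat.mkRat_eq_divInt]
  have := Rat.size_divInt_le (p.num * q.num) (b := ((p.den * q.den : ℕ) : ℤ)) (by
    have := p.den_nz; have := q.den_nz; positivity)
  rw [← h, Int.natAbs_mul, Int.natAbs_natCast] at this
  have h1 := Nat.size_mul_le p.num.natAbs q.num.natAbs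
  have h2 := Nat.size_mul_le p.den q.den
  simp only [encSize_rat]
  omega

theorem encSize_add_le (p q : ℚ) : encSize (p + q) ≤ 2 * (encSize p + encSize q) := by
  have h : p + q = Rat.divInt (p.num * q.den + q.num * p.den) ((p.den * q.den : ℕ) : ℤ) := by
    rw [Rat.add_def, Rat.normalize_eq_mkRat, Rat.mkRat_eq_divInt]
  have := Rat.size_divInt_le (p.num * q.den + q.num * p.den) (b := ((p.den * q.den : ℕ) : ℤ)) (by
    have := p.den_nz; have := q.den_nz; positivity)
  rw [← h, Int.natAbs_natCast] at this
  have h0 := Nat.size_le_size (Int.natAbs_add_le (p.num * q.den) (q.num * p.den))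
  have h1 := Nat.size_add_le (p.num * q.den).natAbs (q.num * p.den).natAbs
  rw [Int.natAbs_mul, Int.natAbs_mul, Int.natAbs_natCast, Int.natAbs_natCast] at h0 h1
  have h2 := Nat.size_mul_le p.den q.den
  have h3 := Nat.size_mul_le p.num.natAbs q.den
  have h4 := Nat.size_mul_le q.num.natAbs p.den
  simp only [encSize_rat]
  omega

theorem encSize_inv_le (q : ℚ) : encSize q⁻¹ ≤ encSize q + 1 := by
  rcases eq_or_ne q 0 with rfl | hq
  · simp
  · have h : q⁻¹ = Rat.divInt q.den q.num := by
      rw [← Rat.inv_divInt, Rat.num_divInt_den]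
    have := Rat.size_divInt_le (q.den : ℤ) (Rat.num_ne_zero.2 hq)
    rw [← h, Int.natAbs_natCast] at this
    simp only [encSize_rat]
    omega

namespace PolyTime

theorem add {f g : α → ℚ} (hf : PolyTime f) (hg : PolyTime g) : PolyTime (fun a => f a + g a) :=
  comp (of_prim (f := fun x : ℚ × ℚ => x.1 + x.2) .add (fun _ => rfl) (2 * .X) fun x => by
    have := encSize_add_le x.1 x.2
    simp [encSize_prod]; omega) (prodMk hf hg)

theorem mul {f g : α → ℚ} (hf : PolyTime f) (hg : PolyTime g) : PolyTime (fun a => f a * g a) :=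
  comp (of_prim (f := fun x : ℚ × ℚ => x.1 * x.2) .mul (fun _ => rfl) .X fun x => by
    have := encSize_mul_le x.1 x.2
    simp [encSize_prod]; omega) (prodMk hf hg)

theorem neg {f : α → ℚ} (hf : PolyTime f) : PolyTime (fun a => -f a) :=
  comp (of_prim (f := fun x : ℚ => -x) .neg (fun _ => rfl) .X fun x => by
    simp [encSize_rat]) hf

theorem inv {f : α → ℚ} (hf : PolyTime f) : PolyTime (fun a => (f a)⁻¹) :=
  comp (of_prim (f := fun x : ℚ => x⁻¹) .inv (fun _ => rfl) (.X + 1) fun x => by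
    simpa using encSize_inv_le x) hf

theorem le {f g : α → ℚ} (hf : PolyTime f) (hg : PolyTime g) :
    PolyTime (fun a => decide (f a ≤ g a)) :=
  comp (of_prim (f := fun x : ℚ × ℚ => decide (x.1 ≤ x.2)) .le (fun x =>
    ofProp_eq_enc_decide (x.1 ≤ x.2)) 3 fun a => by
      simpa using encSize_bool_le _) (prodMk hf hg)

theorem sum {ι : Type*} (s : Finset ι) {f : ι → α → ℚ} (hf : ∀ i ∈ s, PolyTime (f i)) :
    PolyTime (fun a => ∑ i ∈ s, f i a) := by
  classical
  induction s using Finset.induction_on with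
  | empty => simpa using const (0 : ℚ)
  | insert i s hi ih =>
    simp only [Finset.sum_insert hi]
    exact (hf i (by simp)).add (ih fun j hj => hf j (by simp [hj]))

theorem prod {ι : Type*} (s : Finset ι) {f : ι → α → ℚ} (hf : ∀ i ∈ s, PolyTime (f i)) :
    PolyTime (fun a => ∏ i ∈ s, f i a) := by
  classical
  induction s using Finset.induction_on with
  | empty => simpa using const (1 : ℚ)
  | insert i s hi ih =>
    simp only [Finset.prod_insert hi]
    exact (hf i (by simp)).mul (ih fun j hj => hf j (by simp [hj]))

/-- The dimension is not part of the input, so the Leibniz formula takes polynomial time. -/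
theorem det {n : ℕ} {A : α → Matrix (Fin n) (Fin n) ℚ} (hA : ∀ i j, PolyTime (fun a => A a i j)) :
    PolyTime (fun a => (A a).det) := by
  simp only [Matrix.det_apply']
  exact sum _ fun τ _ => (const _).mul (prod _ fun i _ => hA _ _)

/-! ### Vectors of a fixed length -/

theorem vecCons {n : ℕ} {f : α → β} {g : α → Fin n → β} (hf : PolyTime f) (hg : PolyTime g) :
    PolyTime (fun a => (Fin.cons (f a) (g a) : Fin (n + 1) → β)) := by
  obtain ⟨P, p, h⟩ := prodMk hf hg
  exact ⟨P, p, fun a => by rw [enc_vecCons]; exact h a⟩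

theorem vec {n : ℕ} {f : α → Fin n → β} (hf : ∀ i, PolyTime (fun a => f a i)) : PolyTime f := by
  induction n with
  | zero => exact (funext fun a => Subsingleton.elim _ _ : (fun _ => Fin.elim0) = f) ▸ const _
  | succ n ih =>
    have := vecCons (hf 0) (ih (f := fun a i => f a i.succ) fun i => hf i.succ)
    refine (funext fun a => ?_ : _ = f) ▸ this
    exact Fin.cons_self_tail (f a)

theorem tail {n : ℕ} {f : α → Fin (n + 1) → β} (hf : PolyTime f) :
    PolyTime (fun a => Fin.tail (f a)) :=
  comp (of_prim (f := fun x : Fin (n + 1) → β => Fin.tail x) .snd (fun x => by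
    conv_lhs => rw [← Fin.cons_self_tail x, enc_vecCons]
    rfl) .X fun x => by
      conv_rhs => rw [← Fin.cons_self_tail x, encSize, enc_vecCons]
      simp [Val.size, encSize]) hf

theorem apply {n : ℕ} {f : α → Fin n → β} (hf : PolyTime f) (i : Fin n) :
    PolyTime (fun a => f a i) := by
  induction n with
  | zero => exact i.elim0
  | succ n ih =>
    refine Fin.cases ?_ (fun i => ?_) i
    · refine comp (of_prim (f := fun x : Fin (n + 1) → β => x 0) .fst (fun x => ?_) .X
        fun x => ?_) hf
      · conv_lhs => rw [← Fin.cons_self_tail x, enc_vecCons]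
        rfl
      · conv_rhs => rw [← Fin.cons_self_tail x, encSize, enc_vecCons]
        simp [Val.size, encSize]; omega
    · exact ih hf.tail i

theorem dotProduct {n : ℕ} {f g : α → Fin n → ℚ} (hf : PolyTime f) (hg : PolyTime g) :
    PolyTime (fun a => f a ⬝ᵥ g a) :=
  sum _ fun i _ => (hf.apply i).mul (hg.apply i)

/-! ### Lists -/

theorem isEmpty {l : α → List β} (hl : PolyTime l) : PolyTime (fun a => (l a).isEmpty) := by
  have : PolyTime (fun l : List β => !l.isEmpty) :=
    of_prim .isPair (fun l => by
      change Val.ofProp _ = _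
      rw [← Bool.decide_eq_true (b := !l.isEmpty), ← ofProp_eq_enc_decide]
      congr 1
      cases l <;> simp [enc, Val.ofList]) 3 fun a => by simpa using encSize_bool_le _
  simpa using (this.comp hl).not

theorem cons {f : α → β} {l : α → List β} (hf : PolyTime f) (hl : PolyTime l) :
    PolyTime (fun a => f a :: l a) :=
  let ⟨P, p, h⟩ := prodMk hf hl; ⟨P, p, fun a => h a⟩

theorem headD {f : α → β} {l : α → List β} (hf : PolyTime f) (hl : PolyTime l) :
    PolyTime (fun a => (l a).headD (f a)) := by
  have hn : PolyTime (fun x : β × List β => !x.2.isEmpty) := (isEmpty (snd id)).not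
  obtain ⟨C, r, hC⟩ := hn
  refine comp (f := fun a => (f a, l a)) (g := fun x : β × List β => x.2.headD x.1)
    ⟨.cond C (.comp (.prim .fst) (.prim .snd)) (.prim .fst), r + 4 * .X + 10, fun x => ?_⟩
    (prodMk hf hl)
  obtain ⟨b, l⟩ := x
  have hx := hC (b, l)
  cases l with
  | nil =>
    refine (Prog.RunsWithin.cond_false hx ⟨_, .prim .fst _, le_rfl⟩).mono ?_
    simp only [Prim.eval, encSize, enc, Val.size, Val.ofList, List.map_nil]
    simp
    omega
  | cons a l =>
    refine (Prog.RunsWithin.cond_true hx ?_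
      (Prog.RunsWithin.comp ⟨_, .prim .fst _, le_rfl⟩ ⟨_, .prim .snd _, le_rfl⟩)).mono ?_
    · simp [enc]
    · simp only [Prim.eval, encSize, enc, Val.size, Val.ofList, List.map_cons]
      simp
      omega

/-- A fold takes polynomial time if no step adds more to the accumulator than a polynomial in the
length of the list element (and of the fixed parameter `c`). -/
theorem foldl_aux {f : γ × σ × α → σ} (hf : PolyTime f) (q : Polynomial ℕ)
    (hq : ∀ c s a, encSize (f (c, s, a)) ≤ encSize s + q.eval (encSize (c, a))) :
    PolyTime (fun x : γ × σ × List α => x.2.2.foldl (fun s a => f (x.1, s, a)) x.2.1) := by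
  -- the body acts on a nonempty list, which is encoded as the pair of its head and its tail
  have hbody : PolyTime (fun x : γ × σ × α × List α => (x.1, f (x.1, x.2.1, x.2.2.1), x.2.2.2)) :=
    prodMk (fst id) (prodMk (hf.comp (prodMk (fst id) (prodMk (fst (snd id))
      (fst (snd (snd id)))))) (snd (snd (snd id))))
  have hcond : PolyTime (fun x : γ × σ × List α => !x.2.2.isEmpty) := (isEmpty (snd (snd id))).not
  obtain ⟨B, p, hB⟩ := hbody
  obtain ⟨C, r, hC⟩ := hcond
  -- `M` bounds all accumulators that occur, hence the length of every state of the loop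
  have key : ∀ (c : γ) (l : List α) (s : σ) (M : ℕ),
      encSize s + l.length * q.eval (encSize c + encSize l + 1) ≤ M → encSize c + encSize l ≤ M →
      (Prog.loop C B).RunsWithin (enc (c, s, l)) (enc (c, l.foldl (fun s a => f (c, s, a)) s,
        ([] : List α))) ((l.length + 1) * (p.eval (2 * M + 2) + r.eval (2 * M + 2) + 1)) := by
    intro c l
    induction l with
    | nil =>
      intro s M hM _
      obtain ⟨t, ht, htb⟩ := hC (c, s, [])
      have hsz : encSize (c, s, ([] : List α)) ≤ 2 * M + 2 := by
        simp only [encSize_prod, encSize_nil] at *; omega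
      have := r.eval_le_eval_nat hsz
      exact ⟨_, .loop_exit ht, by simp; omega⟩
    | cons a l ih =>
      intro s M hM hM'
      obtain ⟨t, ht, htb⟩ := hC (c, s, a :: l)
      obtain ⟨t', ht', htb'⟩ := hB (c, s, a, l)
      rw [encSize_cons] at hM hM'
      have h1 : q.eval (encSize c + encSize l + 1) ≤
        q.eval (encSize c + (1 + encSize a + encSize l) + 1) := q.eval_le_eval_nat (by omega)
      have h2 : q.eval (encSize (c, a)) ≤
        q.eval (encSize c + (1 + encSize a + encSize l) + 1) :=
          q.eval_le_eval_nat (by simp only [encSize_prod]; omega)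
      have h3 := hq c s a
      have h4 := Nat.mul_le_mul_left l.length h1
      rw [List.length_cons, Nat.succ_mul] at hM
      obtain ⟨t'', ht'', htb''⟩ := ih (f (c, s, a)) M (by omega) (by omega)
      refine ⟨_, .loop_step ht (by simp [enc]) ht' ht'', ?_⟩
      have hsz : encSize (c, s, a :: l) ≤ 2 * M + 2 := by
        simp only [encSize_prod, encSize_cons] at *; omega
      have hsz' : encSize (c, s, a, l) ≤ 2 * M + 2 := hsz
      have h5 := r.eval_le_eval_nat hsz
      have h6 := p.eval_le_eval_nat hsz'
      rw [List.length_cons, Nat.succ_mul]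
      omega
  have hloop : PolyTime (fun x : γ × σ × List α =>
      (x.1, x.2.2.foldl (fun s a => f (x.1, s, a)) x.2.1, ([] : List α))) := by
    refine ⟨.loop C B, .X * ((p + r).comp (2 * (.X + .X * q) + 2) + 1), fun x => ?_⟩
    obtain ⟨c, s, l⟩ := x
    set n := encSize (c, s, l) with hn
    have hn' : n = 1 + encSize c + (1 + encSize s + encSize l) := rfl
    have hl := length_lt_encSize l
    have hle : q.eval (encSize c + encSize l + 1) ≤ q.eval n := q.eval_le_eval_nat (by omega)
    refine (key c l s (n + n * q.eval n) ?_ ?_).mono ?_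
    · have : l.length * q.eval (encSize c + encSize l + 1) ≤ n * q.eval n :=
        Nat.mul_le_mul (by omega) hle
      omega
    · nlinarith
    · simp only [Polynomial.eval_mul, Polynomial.eval_X, Polynomial.eval_comp, Polynomial.eval_add,
        Polynomial.eval_one, Polynomial.eval_ofNat]
      exact Nat.mul_le_mul (by omega) le_rfl
  exact fst (snd hloop)

theorem foldl {δ : Type} [Enc δ] {l : δ → List α} {i : δ → σ} {f : δ → σ → α → σ}
    (hl : PolyTime l) (hi : PolyTime i) (hf : PolyTime (fun x : δ × σ × α => f x.1 x.2.1 x.2.2))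
    (q : Polynomial ℕ)
    (hq : ∀ c s a, encSize (f c s a) ≤ encSize s + q.eval (encSize (c, a))) :
    PolyTime (fun d => (l d).foldl (f d) (i d)) :=
  (foldl_aux hf q hq).comp (prodMk id (prodMk hi hl))

theorem reverse {l : α → List β} (hl : PolyTime l) : PolyTime (fun a => (l a).reverse) := by
  have : PolyTime (fun a => (l a).foldl (fun s b => b :: s) []) :=
    foldl (f := fun _ s b => b :: s) hl (const []) (cons (snd (snd id)) (fst (snd id))) (.X + 1)
      fun c s b => by simp [encSize_cons, encSize_prod]; omega
  simpa using this

theorem append {l l' : α → List β} (hl : PolyTime l) (hl' : PolyTime l') :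
    PolyTime (fun a => l a ++ l' a) := by
  have : PolyTime (fun a => (l a).reverse.foldl (fun s b => b :: s) (l' a)) :=
    foldl (f := fun _ s b => b :: s) hl.reverse hl' (cons (snd (snd id)) (fst (snd id))) (.X + 1)
      fun c s b => by simp [encSize_cons, encSize_prod]; omega
  simpa using this

theorem flatMap {l : α → List β} {g : α → β → List γ} (hl : PolyTime l)
    (hg : PolyTime (fun x : α × β => g x.1 x.2)) : PolyTime (fun a => (l a).flatMap (g a)) := by
  obtain ⟨q, hq⟩ := hg.encSize_le
  have : PolyTime (fun a => (l a).foldl (fun s b => s ++ g a b) []) :=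
    foldl (f := fun a s b => s ++ g a b) hl (const [])
      (append (fst (snd id)) (hg.comp (prodMk (fst id) (snd (snd id))))) q
      fun c s b => by
        have := encSize_append s (g c b)
        have := hq (c, b)
        simp only at this
        omega
  simpa [List.flatMap_eq_foldl] using this

theorem map {l : α → List β} {g : α → β → γ} (hl : PolyTime l)
    (hg : PolyTime (fun x : α × β => g x.1 x.2)) : PolyTime (fun a => (l a).map (g a)) := by
  have := flatMap (g := fun a b => [g a b]) hl (cons hg (const []))
  simpa [List.map_eq_flatMap] using this

theorem filter {l : α → List β} {c : α → β → Bool} (hl : PolyTime l)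
    (hc : PolyTime (fun x : α × β => c x.1 x.2)) : PolyTime (fun a => (l a).filter (c a)) := by
  have := flatMap (g := fun a b => if c a b then [b] else []) hl
    (ite hc (cons (snd id) (const [])) (const []))
  refine (funext fun a => ?_ : _ = fun a => (l a).filter (c a)) ▸ this
  induction l a with
  | nil => rfl
  | cons b l ih => rw [List.flatMap_cons, ih, List.filter_cons]; split <;> simp

theorem all {l : α → List β} {c : α → β → Bool} (hl : PolyTime l)
    (hc : PolyTime (fun x : α × β => c x.1 x.2)) : PolyTime (fun a => (l a).all (c a)) := by
  have := isEmpty (filter (c := fun a b => !c a b) hl hc.not)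
  refine (funext fun a => ?_ : _ = fun a => (l a).all (c a)) ▸ this
  rw [Bool.eq_iff_iff]
  simp

end PolyTime

end

/-! ### Vectors orthogonal to `d` vectors of dimension `d + 1` -/

section CrossProduct

variable {K : Type*} [Field K] {d : ℕ}

/-- The generalized cross product of `d` vectors of dimension `d + 1`: the vector that represents
the linear form `x ↦ det (x, t₁, …, t_d)`. -/
def crossVec (t : Fin d → Fin (d + 1) → K) : Fin (d + 1) → K := fun j =>
  (Matrix.of (Fin.cons (Pi.single j 1) t : Fin (d + 1) → Fin (d + 1) → K)).det

theorem crossVec_dotProduct (t : Fin d → Fin (d + 1) → K) (x : Fin (d + 1) → K) :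
    crossVec t ⬝ᵥ x = (Matrix.of (Fin.cons x t : Fin (d + 1) → Fin (d + 1) → K)).det := by
  have h : ∀ y : Fin (d + 1) → K,
      (Matrix.of (Fin.cons y t : Fin (d + 1) → Fin (d + 1) → K)).det =
        ∑ j : Fin (d + 1), (-1) ^ (j : ℕ) * y j *
          (Matrix.of fun i k => t i (j.succAbove k) : Matrix (Fin d) (Fin d) K).det := by
    intro y
    rw [Matrix.det_succ_row_zero]
    rfl
  simp only [dotProduct, crossVec]
  rw [h]
  refine Finset.sum_congr rfl fun j _ => ?_
  rw [h, Finset.sum_eq_single j]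
  · simp; ring
  · intro k _ hk; simp [Pi.single_eq_of_ne hk]
  · simp

theorem crossVec_dotProduct_self (t : Fin d → Fin (d + 1) → K) (k : Fin d) :
    crossVec t ⬝ᵥ t k = 0 := by
  rw [crossVec_dotProduct]
  exact Matrix.det_zero_of_row_eq (i := 0) (j := k.succ) (Fin.succ_ne_zero k).symm rfl

theorem linearIndependent_of_crossVec_ne_zero {t : Fin d → Fin (d + 1) → K}
    (h : crossVec t ≠ 0) : LinearIndependent K t := by
  obtain ⟨j, hj⟩ := Function.ne_iff.1 h
  exact (linearIndependent_finCons.1 (Matrix.linearIndependent_rows_of_det_ne_zero hj)).1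

theorem exists_crossVec_eq_smul {t : Fin d → Fin (d + 1) → K} (ht : LinearIndependent K t)
    {u : Fin (d + 1) → K} (hu : u ≠ 0) (hut : ∀ k, u ⬝ᵥ t k = 0) :
    ∃ c : K, c ≠ 0 ∧ crossVec t = c • u := by
  obtain ⟨x, hx⟩ : ∃ x, x ∉ Submodule.span K (Set.range t) := by
    by_contra! hcon
    have h1 := finrank_span_eq_card ht
    rw [Submodule.eq_top_iff'.2 hcon, finrank_top] at h1
    simp at h1
  have hli := linearIndependent_finCons.2 ⟨ht, hx⟩
  have hspan := hli.span_eq_top_of_card_eq_finrank (by simp)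
  have hker : ∀ v : Fin (d + 1) → K, v ⬝ᵥ x = 0 → (∀ k, v ⬝ᵥ t k = 0) → v = 0 := by
    intro v hvx hvt
    refine dotProduct_eq_zero _ fun y => ?_
    have hy : y ∈ Submodule.span K (Set.range (Fin.cons x t : Fin (d + 1) → _)) :=
      hspan ▸ Submodule.mem_top
    induction hy using Submodule.span_induction with
    | mem y hy =>
      obtain ⟨i, rfl⟩ := hy
      refine Fin.cases ?_ (fun k => ?_) i
      · simpa using hvx
      · simpa using hvt k
    | zero => simp
    | add y z _ _ hy hz => rw [dotProduct_add, hy, hz, add_zero]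
    | smul a y _ hy => rw [dotProduct_smul, hy, smul_zero]
  have hux : u ⬝ᵥ x ≠ 0 := fun h => hu (hker u h hut)
  have hcx : crossVec t ⬝ᵥ x ≠ 0 := by
    rw [crossVec_dotProduct]
    have h1 : IsUnit (Matrix.of (Fin.cons x t : Fin (d + 1) → Fin (d + 1) → K)) :=
      Matrix.linearIndependent_rows_iff_isUnit.1 hli
    exact ((Matrix.isUnit_iff_isUnit_det _).1 h1).ne_zero
  refine ⟨crossVec t ⬝ᵥ x / u ⬝ᵥ x, div_ne_zero hcx hux, ?_⟩
  rw [← sub_eq_zero]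
  refine hker _ ?_ fun k => ?_
  · rw [sub_dotProduct, smul_dotProduct, smul_eq_mul, div_mul_cancel₀ _ hux, sub_self]
  · rw [sub_dotProduct, smul_dotProduct, hut, crossVec_dotProduct_self, smul_zero, sub_self]

/-- The cross product, scaled so that the entries after the first one have sum `1` (and zero if
their sum vanishes). -/
def normalVec (t : Fin d → Fin (d + 1) → K) : Fin (d + 1) → K :=
  (∑ i : Fin d, crossVec t i.succ)⁻¹ • crossVec t

theorem sum_normalVec {t : Fin d → Fin (d + 1) → K} (h : normalVec t ≠ 0) :
    ∑ i : Fin d, normalVec t i.succ = 1 := by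
  have hs : ∑ i : Fin d, crossVec t i.succ ≠ 0 := fun hs => h (by simp [normalVec, hs])
  simp only [normalVec, Pi.smul_apply, smul_eq_mul]
  rw [← Finset.mul_sum, inv_mul_cancel₀ hs]

theorem normalVec_dotProduct_self (t : Fin d → Fin (d + 1) → K) (k : Fin d) :
    normalVec t ⬝ᵥ t k = 0 := by
  rw [normalVec, smul_dotProduct, crossVec_dotProduct_self, smul_zero]

theorem linearIndependent_of_normalVec_ne_zero {t : Fin d → Fin (d + 1) → K}
    (h : normalVec t ≠ 0) : LinearIndependent K t :=
  linearIndependent_of_crossVec_ne_zero fun hc => h (by simp [normalVec, hc])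

theorem normalVec_eq {t : Fin d → Fin (d + 1) → K} (ht : LinearIndependent K t)
    {u : Fin (d + 1) → K} (hu : u ≠ 0) (hut : ∀ k, u ⬝ᵥ t k = 0) :
    normalVec t = (∑ i : Fin d, u i.succ)⁻¹ • u := by
  obtain ⟨c, hc, h⟩ := exists_crossVec_eq_smul ht hu hut
  simp only [normalVec, h, Pi.smul_apply, smul_eq_mul, smul_smul]
  rw [← Finset.mul_sum, mul_inv, mul_right_comm, inv_mul_cancel₀ hc, one_mul]

theorem map_normalVec {L : Type*} [Field L] (φ : K →+* L) (t : Fin d → Fin (d + 1) → K)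
    (j : Fin (d + 1)) : φ (normalVec t j) = normalVec (fun k i => φ (t k i)) j := by
  have h : ∀ j, φ (crossVec t j) = crossVec (fun k i => φ (t k i)) j := by
    intro j
    rw [crossVec, crossVec, RingHom.map_det]
    congr 1
    ext i k
    refine Fin.cases ?_ (fun i => ?_) i
    · simp [Pi.single_apply, apply_ite φ]
    · simp
  simp [normalVec, h]

end CrossProduct

/-! ### Facets of the inner approximation polyhedron -/

section Facets

variable {d : ℕ}

/-- The homogenization of the point `y`. -/
def liftPoint {K : Type*} [One K] (y : Fin d → K) : Fin (d + 1) → K := Fin.cons 1 y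

/-- The homogenization of the direction of the `i`-th coordinate axis. -/
def liftAxis (K : Type*) [Zero K] [One K] (i : Fin d) : Fin (d + 1) → K :=
  Fin.cons 0 (Pi.single i 1)

theorem dotProduct_liftPoint {K : Type*} [Semiring K] (u : Fin (d + 1) → K) (y : Fin d → K) :
    u ⬝ᵥ liftPoint y = u 0 + ∑ i : Fin d, u i.succ * y i := by
  simp [dotProduct, Fin.sum_univ_succ, liftPoint]

theorem dotProduct_liftAxis {K : Type*} [Semiring K] (u : Fin (d + 1) → K) (i : Fin d) :
    u ⬝ᵥ liftAxis K i = u i.succ := by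
  simp [dotProduct, Fin.sum_univ_succ, liftAxis, Pi.single_apply]

/-- The polyhedron `conv Y + ℝ^d_{≥0}`. -/
def upperHull (Y : Set (Fin d → ℝ)) : Set (Fin d → ℝ) := convexHull ℝ Y + {z | 0 ≤ z}

theorem mem_upperHull {Y : Set (Fin d → ℝ)} {z : Fin d → ℝ} :
    z ∈ upperHull Y ↔ ∃ v ∈ convexHull ℝ Y, v ≤ z := by
  constructor
  · rintro ⟨v, hv, s, hs, rfl⟩
    exact ⟨v, hv, le_add_of_nonneg_right hs⟩
  · rintro ⟨v, hv, hvz⟩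
    exact ⟨v, hv, z - v, sub_nonneg.2 hvz, by simp⟩

/-- The homogenized generators of `conv Y + ℝ^d_{≥0}`. -/
def gens (Y : Set (Fin d → ℝ)) : Set (Fin (d + 1) → ℝ) :=
  liftPoint '' Y ∪ Set.range (liftAxis ℝ)

theorem gens_finite {Y : Set (Fin d → ℝ)} (hY : Y.Finite) : (gens Y).Finite :=
  (hY.image _).union (Set.finite_range _)

/-- The generators on which the linear form `u` vanishes. -/
def tight (Y : Set (Fin d → ℝ)) (u : Fin (d + 1) → ℝ) : Set (Fin (d + 1) → ℝ) :=
  {g ∈ gens Y | u ⬝ᵥ g = 0}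

theorem mem_halfspace_tail {u : Fin (d + 1) → ℝ} {z : Fin d → ℝ} :
    z ∈ halfspace (Fin.tail u) (-u 0) ↔ 0 ≤ u ⬝ᵥ liftPoint z := by
  rw [dotProduct_liftPoint, halfspace, Set.mem_ofPred_eq, neg_le_iff_add_nonneg']
  rfl

theorem mem_hyperplane_tail {u : Fin (d + 1) → ℝ} {z : Fin d → ℝ} :
    z ∈ hyperplane (Fin.tail u) (-u 0) ↔ u ⬝ᵥ liftPoint z = 0 := by
  rw [dotProduct_liftPoint, add_comm (u 0), add_eq_zero_iff_eq_neg]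
  rfl

theorem le_dotProduct_liftPoint {u : Fin (d + 1) → ℝ} (hu : ∀ i : Fin d, 0 ≤ u i.succ)
    {v z : Fin d → ℝ} (h : v ≤ z) : u ⬝ᵥ liftPoint v ≤ u ⬝ᵥ liftPoint z := by
  rw [dotProduct_liftPoint, dotProduct_liftPoint]
  gcongr with i _
  · exact hu i
  · exact h i

theorem upperHull_subset_halfspace_iff {Y : Set (Fin d → ℝ)} (hY : Y.Nonempty)
    {u : Fin (d + 1) → ℝ} :
    upperHull Y ⊆ halfspace (Fin.tail u) (-u 0) ↔ ∀ g ∈ gens Y, 0 ≤ u ⬝ᵥ g := by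
  constructor
  · intro h g hg
    have hmem : ∀ y ∈ Y, ∀ z, y ≤ z → 0 ≤ u ⬝ᵥ liftPoint z := fun y hy z hz =>
      mem_halfspace_tail.1 (h (mem_upperHull.2 ⟨y, subset_convexHull ℝ Y hy, hz⟩))
    rcases hg with ⟨y, hy, rfl⟩ | ⟨i, rfl⟩
    · exact hmem y hy y le_rfl
    · obtain ⟨y, hy⟩ := hY
      rw [dotProduct_liftAxis]
      by_contra! hneg
      -- far enough along the axis, the linear form would become negative
      set a := u ⬝ᵥ liftPoint y with ha
      have ha0 : 0 ≤ a := hmem y hy y le_rfl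
      set s := (a + 1) / (-u i.succ) with hs
      have hs0 : 0 ≤ s := div_nonneg (by linarith) (by linarith)
      have := hmem y hy (y + Pi.single i s) (le_add_of_nonneg_right (by
        intro j; by_cases hj : j = i
        · subst hj; simpa using hs0
        · simp [Pi.single_eq_of_ne hj]))
      have heq : u ⬝ᵥ liftPoint (y + Pi.single i s) = a + u i.succ * s := by
        rw [ha, dotProduct_liftPoint, dotProduct_liftPoint]
        simp [mul_add, Finset.sum_add_distrib, Pi.single_apply, add_assoc]
      have hs' : u i.succ * s = -(a + 1) := by
        rw [hs, div_neg, mul_neg, mul_div_cancel₀ _ hneg.ne]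
      linarith
  · intro h z hz
    obtain ⟨v, hv, hvz⟩ := mem_upperHull.1 hz
    have hpos : ∀ i : Fin d, 0 ≤ u i.succ := fun i =>
      dotProduct_liftAxis u i ▸ h _ (Or.inr ⟨i, rfl⟩)
    have hconv : Convex ℝ (halfspace (Fin.tail u) (-u 0)) := by
      refine convex_halfSpace_ge (f := fun z : Fin d → ℝ => ∑ i : Fin d, u i.succ * z i) ?_ _
      exact ⟨fun x y => by simp [mul_add, Finset.sum_add_distrib],
        fun c x => by simp [Finset.mul_sum, mul_left_comm]⟩
    have hv' := convexHull_min (fun y hy => mem_halfspace_tail.2 (h _ (Or.inl ⟨y, hy, rfl⟩)))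
      hconv hv
    exact mem_halfspace_tail.2 ((mem_halfspace_tail.1 hv').trans (le_dotProduct_liftPoint hpos hvz))

theorem succ_nonneg_of_valid {Y : Set (Fin d → ℝ)} {u : Fin (d + 1) → ℝ}
    (h : ∀ g ∈ gens Y, 0 ≤ u ⬝ᵥ g) (i : Fin d) : 0 ≤ u i.succ :=
  dotProduct_liftAxis u i ▸ h _ (Or.inr ⟨i, rfl⟩)

theorem liftPoint_add (y : Fin d → ℝ) (s : Fin d → ℝ) :
    liftPoint (y + s) = liftPoint y + ∑ i, s i • liftAxis ℝ i := by
  ext j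
  refine Fin.cases ?_ (fun j => ?_) j
  · simp [liftPoint, liftAxis]
  · simp [liftPoint, liftAxis, Pi.single_apply]

/-- The points of the face cut out by a valid linear form are combinations of the generators on
which this form vanishes. -/
theorem liftPoint_mem_span_tight {Y : Set (Fin d → ℝ)} {u : Fin (d + 1) → ℝ}
    (h : ∀ g ∈ gens Y, 0 ≤ u ⬝ᵥ g) {p : Fin d → ℝ} (hp : p ∈ upperHull Y)
    (hup : u ⬝ᵥ liftPoint p = 0) : liftPoint p ∈ Submodule.span ℝ (tight Y u) := by
  obtain ⟨v, hv, s, hs, rfl⟩ := hp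
  simp only [Set.mem_ofPred_eq] at hs
  obtain ⟨ι, _, w, y, hw, hw1, hy, rfl⟩ := mem_convexHull_iff_exists_fintype.1 hv
  have hlin : liftPoint (∑ i, w i • y i) = ∑ i, w i • liftPoint (y i) := by
    ext j
    refine Fin.cases ?_ (fun j => ?_) j
    · simp [liftPoint, hw1]
    · simp [liftPoint]
  rw [liftPoint_add, hlin] at hup ⊢
  have h1 : ∀ i, 0 ≤ w i * (u ⬝ᵥ liftPoint (y i)) := fun i =>
    mul_nonneg (hw i) (h _ (Or.inl ⟨_, hy i, rfl⟩))
  have h2 : ∀ i, 0 ≤ s i * (u ⬝ᵥ liftAxis ℝ i) := fun i =>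
    mul_nonneg (hs i) (h _ (Or.inr ⟨i, rfl⟩))
  rw [dotProduct_add, dotProduct_sum, dotProduct_sum] at hup
  simp only [dotProduct_smul, smul_eq_mul] at hup
  rw [add_eq_zero_iff_of_nonneg (Finset.sum_nonneg fun i _ => h1 i)
    (Finset.sum_nonneg fun i _ => h2 i), Finset.sum_eq_zero_iff_of_nonneg fun i _ => h1 i,
    Finset.sum_eq_zero_iff_of_nonneg fun i _ => h2 i] at hup
  refine add_mem (sum_mem fun i hi => ?_) (sum_mem fun i hi => ?_)
  · rcases mul_eq_zero.1 (hup.1 i hi) with h0 | h0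
    · simp [h0]
    · exact Submodule.smul_mem _ _ (Submodule.subset_span ⟨Or.inl ⟨_, hy i, rfl⟩, h0⟩)
  · rcases mul_eq_zero.1 (hup.2 i hi) with h0 | h0
    · simp [h0]
    · exact Submodule.smul_mem _ _ (Submodule.subset_span ⟨Or.inr ⟨i, rfl⟩, h0⟩)

/-- The linear map `(s, v) ↦ s (1, p) + (0, v)`, which compares the directions of an affine
subspace through `p` with the linear span of its homogenization. -/
def liftDirection (D : Submodule ℝ (Fin d → ℝ)) (p : Fin d → ℝ) :
    ℝ × D →ₗ[ℝ] (Fin (d + 1) → ℝ) :=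
  (LinearMap.toSpanSingleton ℝ _ (liftPoint p)).coprod
    ({ toFun := fun v => Fin.cons 0 v
       map_add' := fun x y => by
        ext j; refine Fin.cases ?_ (fun j => ?_) j <;> simp
       map_smul' := fun c x => by
        ext j; refine Fin.cases ?_ (fun j => ?_) j <;> simp } ∘ₗ D.subtype)

theorem liftDirection_apply (D : Submodule ℝ (Fin d → ℝ)) (p : Fin d → ℝ) (s : ℝ) (v : D) :
    liftDirection D p (s, v) = s • liftPoint p + Fin.cons 0 (v : Fin d → ℝ) := rfl

theorem liftDirection_injective (D : Submodule ℝ (Fin d → ℝ)) (p : Fin d → ℝ) :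
    Function.Injective (liftDirection D p) := by
  rw [← LinearMap.ker_eq_bot, LinearMap.ker_eq_bot']
  rintro ⟨s, v⟩ h
  rw [liftDirection_apply] at h
  have h0 := congrFun h 0
  simp only [liftPoint, Pi.add_apply, Pi.smul_apply, Fin.cons_zero, Pi.zero_apply, smul_eq_mul,
    mul_one, add_zero] at h0
  subst h0
  have hv : (v : Fin d → ℝ) = 0 := by
    ext i
    simpa using congrFun h i.succ
  simp only [Prod.mk_eq_zero, true_and]
  exact Subtype.ext hv

/-- The dimension of a face is one less than the rank of the homogenized generators on it. -/
theorem finrank_span_tight {Y : Set (Fin d → ℝ)} {u : Fin (d + 1) → ℝ}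
    (h : ∀ g ∈ gens Y, 0 ≤ u ⬝ᵥ g)
    (hne : (upperHull Y ∩ hyperplane (Fin.tail u) (-u 0)).Nonempty) :
    Module.finrank ℝ (Submodule.span ℝ (tight Y u)) =
      affDim (upperHull Y ∩ hyperplane (Fin.tail u) (-u 0)) + 1 := by
  set S := upperHull Y ∩ hyperplane (Fin.tail u) (-u 0) with hS
  obtain ⟨p, hp⟩ := hne
  have hD := vectorSpan_eq_span_vsub_set_right ℝ hp
  have hsub : ∀ q ∈ S, q - p ∈ vectorSpan ℝ S := fun q hq => by
    simpa using vsub_mem_vectorSpan ℝ hq hp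
  have hrange : LinearMap.range (liftDirection (vectorSpan ℝ S) p) =
      Submodule.span ℝ (tight Y u) := by
    apply le_antisymm
    · rintro _ ⟨⟨s, v, hv⟩, rfl⟩
      have hspan : ∀ q ∈ S, liftPoint q ∈ Submodule.span ℝ (tight Y u) := fun q hq =>
        liftPoint_mem_span_tight h hq.1 (mem_hyperplane_tail.1 hq.2)
      rw [liftDirection_apply]
      refine add_mem (Submodule.smul_mem _ _ (hspan p hp)) ?_
      dsimp only
      rw [hD] at hv
      induction hv using Submodule.span_induction with
      | mem v hv =>
        obtain ⟨q, hq, rfl⟩ := hv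
        convert sub_mem (hspan q hq) (hspan p hp) using 1
        ext j; refine Fin.cases ?_ (fun j => ?_) j <;> simp [liftPoint]
      | zero =>
        convert Submodule.zero_mem _ using 1
        ext j; refine Fin.cases ?_ (fun j => ?_) j <;> simp
      | add x y _ _ hx hy =>
        convert add_mem hx hy using 1
        ext j; refine Fin.cases ?_ (fun j => ?_) j <;> simp
      | smul c x _ hx =>
        convert Submodule.smul_mem _ c hx using 1
        ext j; refine Fin.cases ?_ (fun j => ?_) j <;> simp
    · rw [Submodule.span_le]
      rintro g ⟨⟨y, hy, rfl⟩ | ⟨i, rfl⟩, hg⟩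
      · refine ⟨(1, ⟨y - p, hsub y ⟨mem_upperHull.2 ⟨y, subset_convexHull ℝ Y hy, le_rfl⟩,
          mem_hyperplane_tail.2 hg⟩⟩), ?_⟩
        rw [liftDirection_apply]
        ext j; refine Fin.cases ?_ (fun j => ?_) j <;> simp [liftPoint]
      · have hmem : p + Pi.single i 1 ∈ S := by
          refine ⟨?_, mem_hyperplane_tail.2 ?_⟩
          · obtain ⟨v, hv, hvp⟩ := mem_upperHull.1 hp.1
            refine mem_upperHull.2 ⟨v, hv, hvp.trans (le_add_of_nonneg_right ?_)⟩
            exact Pi.single_nonneg.2 zero_le_one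
          · rw [liftPoint_add]
            simp only [Pi.single_apply, ite_smul, one_smul, zero_smul, Finset.sum_ite_eq',
              Finset.mem_univ, if_true]
            rw [dotProduct_add, hg, mem_hyperplane_tail.1 hp.2, add_zero]
        have := hsub _ hmem
        rw [add_sub_cancel_left] at this
        refine ⟨(0, ⟨_, this⟩), ?_⟩
        rw [liftDirection_apply]
        ext j; refine Fin.cases ?_ (fun j => ?_) j <;> simp [liftPoint, liftAxis]
  rw [← hrange, LinearMap.finrank_range_of_inj (liftDirection_injective _ _), affDim,
    direction_affineSpan, Module.finrank_prod, Module.finrank_self, add_comm]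

theorem affDim_upperHull {Y : Set (Fin d → ℝ)} (hY : Y.Nonempty) : affDim (upperHull Y) = d := by
  obtain ⟨y, hy⟩ := hY
  have hmem : ∀ z, y ≤ z → z ∈ upperHull Y := fun z hz =>
    mem_upperHull.2 ⟨y, subset_convexHull ℝ Y hy, hz⟩
  have htop : vectorSpan ℝ (upperHull Y) = ⊤ := by
    rw [Submodule.eq_top_iff']
    intro x
    rw [pi_eq_sum_univ x]
    refine sum_mem fun i _ => Submodule.smul_mem _ _ ?_
    have := vsub_mem_vectorSpan ℝ (hmem (y + Pi.single i 1)
      (le_add_of_nonneg_right (Pi.single_nonneg.2 zero_le_one))) (hmem y le_rfl)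
    rw [vsub_eq_sub, add_sub_cancel_left] at this
    convert this using 1
    ext j
    simp [Pi.single_apply, eq_comm]
  rw [affDim, direction_affineSpan, htop, finrank_top, Module.finrank_fin_fun]

/-- A nonzero linear form that vanishes on generators of rank `d` is, up to normalization, the cross
product of `d` of them. -/
theorem normalVec_of_finrank_span_tight {Y : Set (Fin d → ℝ)} {u : Fin (d + 1) → ℝ} (hu : u ≠ 0)
    (hd : d ≤ Module.finrank ℝ (Submodule.span ℝ (tight Y u))) :
    ∃ t : Fin d → Fin (d + 1) → ℝ, (∀ k, t k ∈ gens Y) ∧ LinearIndependent ℝ t ∧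
      normalVec t = (∑ i : Fin d, u i.succ)⁻¹ • u := by
  obtain ⟨f, hf, -, hli⟩ := Submodule.exists_fun_fin_finrank_span_eq ℝ (tight Y u)
  have hli' := hli.comp (Fin.castLE hd) (Fin.castLE_injective hd)
  exact ⟨_, fun k => (hf _).1, hli', normalVec_eq hli' hu fun k => (hf _).2⟩

/-- The normalized valid linear forms that are determined by `d` generators. -/
def facetNormals (Y : Set (Fin d → ℝ)) : Set (Fin (d + 1) → ℝ) :=
  {h | (∃ t : Fin d → Fin (d + 1) → ℝ, (∀ k, t k ∈ gens Y) ∧ h = normalVec t) ∧ h ≠ 0 ∧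
    ∀ g ∈ gens Y, 0 ≤ h ⬝ᵥ g}

theorem sum_facetNormal {Y : Set (Fin d → ℝ)} {h : Fin (d + 1) → ℝ} (hh : h ∈ facetNormals Y) :
    ∑ i : Fin d, h i.succ = 1 := by
  obtain ⟨⟨t, -, rfl⟩, h0, -⟩ := hh
  exact sum_normalVec h0

theorem sum_succ_pos {u : Fin (d + 1) → ℝ} (hu : ∀ i : Fin d, 0 ≤ u i.succ)
    (hne : Fin.tail u ≠ 0) : 0 < ∑ i : Fin d, u i.succ := by
  refine (Finset.sum_nonneg fun i _ => hu i).lt_of_ne fun h0 => hne ?_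
  ext i
  exact (Finset.sum_eq_zero_iff_of_nonneg fun i _ => hu i).1 h0.symm i (Finset.mem_univ i)

theorem smul_mem_facetNormals {Y : Set (Fin d → ℝ)} {u : Fin (d + 1) → ℝ}
    (h : ∀ g ∈ gens Y, 0 ≤ u ⬝ᵥ g) (hne : Fin.tail u ≠ 0)
    (hd : d ≤ Module.finrank ℝ (Submodule.span ℝ (tight Y u))) :
    (∑ i : Fin d, u i.succ)⁻¹ • u ∈ facetNormals Y := by
  have hu : u ≠ 0 := fun h0 => hne (by rw [h0]; rfl)
  have hpos := sum_succ_pos (succ_nonneg_of_valid h) hne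
  obtain ⟨t, ht, -, heq⟩ := normalVec_of_finrank_span_tight hu hd
  refine ⟨⟨t, ht, heq.symm⟩, smul_ne_zero (inv_ne_zero hpos.ne') hu, fun g hg => ?_⟩
  rw [smul_dotProduct]
  exact smul_nonneg (inv_nonneg.2 hpos.le) (h g hg)

theorem halfspace_smul {u : Fin (d + 1) → ℝ} {c : ℝ} (hc : 0 < c) :
    halfspace (Fin.tail (c • u)) (-(c • u) 0) = halfspace (Fin.tail u) (-u 0) := by
  ext z
  rw [mem_halfspace_tail, mem_halfspace_tail, smul_dotProduct, smul_eq_mul,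
    mul_nonneg_iff_of_pos_left hc]

theorem facetNormal_tail_ne_zero {Y : Set (Fin d → ℝ)} {h : Fin (d + 1) → ℝ}
    (hh : h ∈ facetNormals Y) : Fin.tail h ≠ 0 := by
  intro h0
  have hz : ∑ i : Fin d, h i.succ = 0 := Finset.sum_eq_zero fun i _ => congrFun h0 i
  exact zero_ne_one (hz.symm.trans (sum_facetNormal hh))

/-- The facet-supporting halfspaces of `conv Y + ℝ^d_{≥0}` are those that come from `d` linearly
independent generators. -/
theorem facetHalfspaces_upperHull {Y : Set (Fin d → ℝ)} (hY : Y.Nonempty) :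
    facetHalfspaces (upperHull Y) =
      (fun h => halfspace (Fin.tail h) (-h 0)) '' facetNormals Y := by
  ext H
  constructor
  · rintro ⟨w, c, hw, rfl, hsub, hne, hdim⟩
    obtain ⟨u, rfl, rfl⟩ : ∃ u : Fin (d + 1) → ℝ, w = Fin.tail u ∧ c = -u 0 :=
      ⟨Fin.cons (-c) w, by simp, by simp⟩
    have hval := (upperHull_subset_halfspace_iff hY).1 hsub
    have hpos := sum_succ_pos (succ_nonneg_of_valid hval) hw
    rw [← finrank_span_tight hval hne, affDim_upperHull hY] at hdim
    exact ⟨_, smul_mem_facetNormals hval hw hdim.ge, halfspace_smul (inv_pos.2 hpos)⟩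
  · rintro ⟨h, hh, rfl⟩
    have htail := facetNormal_tail_ne_zero hh
    obtain ⟨⟨t, ht, rfl⟩, h0, hval⟩ := hh
    set h := normalVec t with hdef
    have hli := linearIndependent_of_normalVec_ne_zero h0
    have htight : ∀ k, t k ∈ tight Y h := fun k => ⟨ht k, normalVec_dotProduct_self t k⟩
    have hne : (upperHull Y ∩ hyperplane (Fin.tail h) (-h 0)).Nonempty := by
      by_cases hpt : ∃ k, ∃ y ∈ Y, liftPoint y = t k
      · obtain ⟨k, y, hy, hyk⟩ := hpt
        exact ⟨y, mem_upperHull.2 ⟨y, subset_convexHull ℝ Y hy, le_rfl⟩,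
          mem_hyperplane_tail.2 (hyk ▸ (htight k).2)⟩
      · -- otherwise the form vanishes on `d` different axes
        exfalso
        have hax : ∀ k, ∃ i, liftAxis ℝ i = t k := fun k =>
          (ht k).resolve_left fun ⟨y, hy, hyk⟩ => hpt ⟨k, y, hy, hyk⟩
        choose σ hσ using hax
        have hσi : Function.Injective σ := fun a b hab => hli.injective (by
          rw [← hσ, ← hσ, hab])
        refine htail (funext fun i => ?_)
        obtain ⟨k, rfl⟩ := (Finite.injective_iff_surjective.1 hσi) i
        have := (htight k).2
        rw [← hσ, dotProduct_liftAxis] at this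
        exact this
    refine ⟨_, _, htail, rfl, (upperHull_subset_halfspace_iff hY).2 hval, hne, ?_⟩
    rw [← finrank_span_tight hval hne, affDim_upperHull hY]
    apply le_antisymm
    · have hlt : Submodule.span ℝ (tight Y h) < ⊤ := by
        rw [lt_top_iff_ne_top]
        intro htop
        refine h0 (dotProduct_eq_zero _ fun y => ?_)
        have hy : y ∈ Submodule.span ℝ (tight Y h) := htop ▸ Submodule.mem_top
        induction hy using Submodule.span_induction with
        | mem y hy => exact hy.2
        | zero => simp
        | add y z _ _ hy hz => rw [dotProduct_add, hy, hz, add_zero]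
        | smul a y _ hy => rw [dotProduct_smul, hy, smul_zero]
      have := Submodule.finrank_lt_finrank_of_lt hlt
      rw [finrank_top, Module.finrank_fin_fun] at this
      omega
    · have h1 := finrank_span_eq_card hli
      rw [Fintype.card_fin] at h1
      have h2 := Submodule.finrank_mono (Submodule.span_mono (R := ℝ)
        (Set.range_subset_iff.2 htight))
      omega

/-- A halfspace determines its normalized linear form. -/
theorem halfspace_injOn {h h' : Fin (d + 1) → ℝ} (hs : ∑ i : Fin d, h i.succ = 1)
    (hs' : ∑ i : Fin d, h' i.succ = 1)
    (heq : halfspace (Fin.tail h) (-h 0) = halfspace (Fin.tail h') (-h' 0)) : h = h' := by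
  have hiff : ∀ z, 0 ≤ h ⬝ᵥ liftPoint z ↔ 0 ≤ h' ⬝ᵥ liftPoint z := fun z => by
    rw [← mem_halfspace_tail, heq, mem_halfspace_tail]
  have hconst : ∀ (k : Fin (d + 1) → ℝ), ∑ i : Fin d, k i.succ = 1 → ∀ a : ℝ,
      k ⬝ᵥ liftPoint (fun _ => a) = k 0 + a := fun k hk a => by
    rw [dotProduct_liftPoint, ← Finset.sum_mul, hk, one_mul]
  have h0 : h 0 = h' 0 := by
    have h1 := hiff fun _ => -h 0
    have h2 := hiff fun _ => -h' 0
    rw [hconst h hs, hconst h' hs'] at h1 h2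
    have h3 := h1.1 (by linarith)
    have h4 := h2.2 (by linarith)
    linarith
  ext j
  refine Fin.cases h0 (fun i => ?_) j
  -- the boundary of the first halfspace contains this line, so the second form is constant on it
  have hline : ∀ (k : Fin (d + 1) → ℝ), ∑ i : Fin d, k i.succ = 1 → ∀ a : ℝ,
      k ⬝ᵥ liftPoint (fun l => -h 0 + a * ((Pi.single i 1 : Fin d → ℝ) l - h i.succ)) =
        k 0 - h 0 + a * (k i.succ - h i.succ) := fun k hk a => by
    rw [dotProduct_liftPoint]
    have : ∀ l : Fin d, k l.succ * (-h 0 + a * ((Pi.single i 1 : Fin d → ℝ) l - h i.succ)) =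
        k l.succ * (-h 0 - a * h i.succ) + a * (k l.succ * (Pi.single i 1 : Fin d → ℝ) l) :=
      fun l => by ring
    simp only [this, Finset.sum_add_distrib, ← Finset.mul_sum, ← Finset.sum_mul, hk]
    simp [Pi.single_apply]
    ring
  have key : ∀ a : ℝ, 0 ≤ a * (h' i.succ - h i.succ) := fun a => by
    have := (hiff _).1 (by rw [hline h hs]; simp : 0 ≤ h ⬝ᵥ liftPoint
      (fun l => -h 0 + a * ((Pi.single i 1 : Fin d → ℝ) l - h i.succ)))
    rw [hline h' hs', h0] at this
    simpa using this
  have h1 := key 1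
  have h2 := key (-1)
  linarith

theorem single_dotProduct_eq_apply {n : ℕ} (f : (Fin n → ℝ) →ₗ[ℝ] ℝ) (v : Fin n → ℝ) :
    (fun j => f (Pi.single j 1)) ⬝ᵥ v = f v := by
  conv_rhs => rw [pi_eq_sum_univ' v, map_sum]
  refine Finset.sum_congr rfl fun i _ => ?_
  rw [map_smul, smul_eq_mul, mul_comm]

/-- A linear form that is valid on the generators can be rotated about the generators on which it
vanishes, without changing its value at `z`, until it vanishes on a further one. -/
theorem exists_finrank_span_tight_lt {Y : Set (Fin d → ℝ)} (hY : Y.Finite) (hne : Y.Nonempty)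
    {u z : Fin (d + 1) → ℝ} (h : ∀ g ∈ gens Y, 0 ≤ u ⬝ᵥ g)
    (hd : Module.finrank ℝ (Submodule.span ℝ (tight Y u)) < d) :
    ∃ u' : Fin (d + 1) → ℝ, (∀ g ∈ gens Y, 0 ≤ u' ⬝ᵥ g) ∧ u' ⬝ᵥ z = u ⬝ᵥ z ∧
      Module.finrank ℝ (Submodule.span ℝ (tight Y u)) <
        Module.finrank ℝ (Submodule.span ℝ (tight Y u')) := by
  -- a direction of rotation
  obtain ⟨x, hx0, hxz, hxt⟩ : ∃ x : Fin (d + 1) → ℝ, x ≠ 0 ∧ x ⬝ᵥ z = 0 ∧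
      ∀ g ∈ Submodule.span ℝ (tight Y u), x ⬝ᵥ g = 0 := by
    have hlt : Submodule.span ℝ (tight Y u) ⊔ Submodule.span ℝ {z} < ⊤ := by
      rw [lt_top_iff_ne_top]
      intro htop
      have h1 := Submodule.finrank_add_le_finrank_add_finrank (Submodule.span ℝ (tight Y u))
        (Submodule.span ℝ {z})
      have h2 := finrank_span_le_card (R := ℝ) ({z} : Set (Fin (d + 1) → ℝ))
      rw [htop, finrank_top, Module.finrank_fin_fun] at h1
      simp at h2
      omega
    obtain ⟨f, hf, hker⟩ := Submodule.exists_le_ker_of_lt_top _ hlt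
    have hfx := single_dotProduct_eq_apply f
    refine ⟨fun j => f (Pi.single j 1), fun h0 => hf (LinearMap.ext fun v => ?_), ?_,
      fun g hg => ?_⟩
    · rw [← hfx v, h0]; simp
    · rw [hfx]; exact hker (Submodule.mem_sup_right (Submodule.mem_span_singleton_self z))
    · rw [hfx]; exact hker (Submodule.mem_sup_left hg)
  -- some generator lies on the negative side of `x` or of `-x`
  obtain ⟨g₀, hg₀, hxg₀⟩ : ∃ g ∈ gens Y, x ⬝ᵥ g ≠ 0 := by
    by_contra! hall
    have hsucc : ∀ i : Fin d, x i.succ = 0 := fun i => by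
      rw [← dotProduct_liftAxis x]; exact hall _ (Or.inr ⟨i, rfl⟩)
    obtain ⟨y, hy⟩ := hne
    have h0 := hall _ (Or.inl ⟨y, hy, rfl⟩)
    rw [dotProduct_liftPoint] at h0
    simp only [hsucc, zero_mul, Finset.sum_const_zero, add_zero] at h0
    exact hx0 (funext fun j => Fin.cases h0 hsucc j)
  wlog hneg : x ⬝ᵥ g₀ < 0 generalizing x
  · refine this (x := -x) (neg_ne_zero.2 hx0) (by simp [hxz]) (fun g hg => by simp [hxt g hg])
      (by simpa using hxg₀) ?_
    rw [neg_dotProduct]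
    exact neg_lt_zero.2 (lt_of_le_of_ne (not_lt.1 hneg) hxg₀.symm)
  -- rotate until the first generator is hit
  obtain ⟨g₁, ⟨hg₁, hneg₁⟩, hmin⟩ := Set.exists_min_image {g ∈ gens Y | x ⬝ᵥ g < 0}
    (fun g => u ⬝ᵥ g / -(x ⬝ᵥ g)) ((gens_finite hY).subset (Set.sep_subset _ _)) ⟨g₀, hg₀, hneg⟩
  set s := u ⬝ᵥ g₁ / -(x ⬝ᵥ g₁) with hs
  have hs0 : 0 ≤ s := div_nonneg (h g₁ hg₁) (by linarith)
  have hval : ∀ g, (u + s • x) ⬝ᵥ g = u ⬝ᵥ g + s * (x ⬝ᵥ g) := fun g => by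
    rw [add_dotProduct, smul_dotProduct, smul_eq_mul]
  refine ⟨u + s • x, fun g hg => ?_, by rw [hval, hxz, mul_zero, add_zero], ?_⟩
  · rw [hval]
    rcases lt_or_ge (x ⬝ᵥ g) 0 with hlt | hge
    · have := hmin g ⟨hg, hlt⟩
      rw [le_div_iff₀ (by linarith)] at this
      linarith
    · exact add_nonneg (h g hg) (mul_nonneg hs0 hge)
  · refine Submodule.finrank_lt_finrank_of_lt (lt_of_le_of_ne (Submodule.span_mono ?_) ?_)
    · intro g hg
      refine ⟨hg.1, ?_⟩
      rw [hval, hg.2, hxt g (Submodule.subset_span hg), mul_zero, add_zero]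
    · intro heq
      have : g₁ ∈ Submodule.span ℝ (tight Y u) := by
        rw [heq]
        refine Submodule.subset_span ⟨hg₁, ?_⟩
        rw [hval, hs, div_neg, neg_mul, div_mul_cancel₀ _ hneg₁.ne, add_neg_cancel]
      exact hneg₁.ne (hxt g₁ this)

/-- Repeated rotation leads to a linear form that vanishes on `d` independent generators. -/
theorem exists_valid_finrank_ge {Y : Set (Fin d → ℝ)} (hY : Y.Finite) (hne : Y.Nonempty)
    (z : Fin (d + 1) → ℝ) (n : ℕ) (u : Fin (d + 1) → ℝ) (h : ∀ g ∈ gens Y, 0 ≤ u ⬝ᵥ g)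
    (hn : d ≤ Module.finrank ℝ (Submodule.span ℝ (tight Y u)) + n) :
    ∃ u' : Fin (d + 1) → ℝ, (∀ g ∈ gens Y, 0 ≤ u' ⬝ᵥ g) ∧ u' ⬝ᵥ z = u ⬝ᵥ z ∧
      d ≤ Module.finrank ℝ (Submodule.span ℝ (tight Y u')) := by
  induction n generalizing u with
  | zero => exact ⟨u, h, rfl, hn⟩
  | succ n ih =>
    rcases le_or_gt d (Module.finrank ℝ (Submodule.span ℝ (tight Y u))) with hle | hlt
    · exact ⟨u, h, rfl, hle⟩
    · obtain ⟨u₁, h₁, hz₁, hlt₁⟩ := exists_finrank_span_tight_lt hY hne (z := z) h hlt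
      obtain ⟨u', h', hz', hle'⟩ := ih u₁ h₁ (by omega)
      exact ⟨u', h', hz'.trans hz₁, hle'⟩

theorem isClosed_upperHull {Y : Set (Fin d → ℝ)} (hY : Y.Finite) : IsClosed (upperHull Y) :=
  isClosed_Ici.add_left_of_isCompact (hY.isCompact_convexHull ℝ)

theorem convex_upperHull (Y : Set (Fin d → ℝ)) : Convex ℝ (upperHull Y) :=
  (convex_convexHull ℝ Y).add (convex_Ici 0)

/-- The polyhedron `conv Y + ℝ^d_{≥0}` is the intersection of its facet-supporting halfspaces. -/
theorem mem_upperHull_of_forall_facet {Y : Set (Fin d → ℝ)} (hY : Y.Finite) (hne : Y.Nonempty)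
    {z : Fin d → ℝ} (hz : ∀ H ∈ facetHalfspaces (upperHull Y), z ∈ H) : z ∈ upperHull Y := by
  by_contra hcon
  obtain ⟨f, s, hfz, hf⟩ :=
    geometric_hahn_banach_point_closed (convex_upperHull Y) (isClosed_upperHull hY) hcon
  set u : Fin (d + 1) → ℝ := Fin.cons (-s) fun j => f (Pi.single j 1) with hu
  have hfu : ∀ v, u ⬝ᵥ liftPoint v = f v - s := fun v => by
    have h1 := single_dotProduct_eq_apply (f : (Fin d → ℝ) →ₗ[ℝ] ℝ) v
    rw [dotProduct_liftPoint, hu]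
    simp only [Fin.cons_zero, Fin.cons_succ]
    rw [neg_add_eq_sub]
    exact congrArg (· - s) h1
  have hval : ∀ g ∈ gens Y, 0 ≤ u ⬝ᵥ g := by
    refine (upperHull_subset_halfspace_iff hne).1 fun v hv => mem_halfspace_tail.2 ?_
    rw [hfu]
    linarith [hf v hv]
  obtain ⟨u', hval', hz', hrank⟩ := exists_valid_finrank_ge hY hne (liftPoint z) d u hval (by omega)
  have hneg : u' ⬝ᵥ liftPoint z < 0 := by rw [hz', hfu]; linarith
  have htail : Fin.tail u' ≠ 0 := by
    intro h0
    have hc : ∀ v, u' ⬝ᵥ liftPoint v = u' 0 := fun v => by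
      rw [dotProduct_liftPoint, Finset.sum_eq_zero, add_zero]
      intro i _
      rw [show u' i.succ = 0 from congrFun h0 i, zero_mul]
    obtain ⟨y, hy⟩ := hne
    have := hval' _ (Or.inl ⟨y, hy, rfl⟩)
    rw [hc] at this hneg
    linarith
  have hmem := smul_mem_facetNormals hval' htail hrank
  have := hz _ ((facetHalfspaces_upperHull hne).ge ⟨_, hmem, rfl⟩)
  dsimp only at this
  rw [halfspace_smul (inv_pos.2 (sum_succ_pos (succ_nonneg_of_valid hval') htail)),
    mem_halfspace_tail] at this
  linarith

end Facets

/-! ### Enumeration of the facets -/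

/-- All tuples of length `k` with entries from a list. -/
def tuples {G : Type*} : (k : ℕ) → List G → List (Fin k → G)
  | 0, _ => [Fin.elim0]
  | k + 1, l => l.flatMap fun g => (tuples k l).map fun t => Fin.cons g t

theorem mem_tuples {G : Type*} {k : ℕ} {l : List G} {t : Fin k → G} :
    t ∈ tuples k l ↔ ∀ i, t i ∈ l := by
  induction k with
  | zero => simp only [tuples, List.mem_singleton, IsEmpty.forall_iff, iff_true]; ext i; exact i.elim0
  | succ k ih =>
    simp only [tuples, List.mem_flatMap, List.mem_map, ih]
    constructor
    · rintro ⟨g, hg, t, ht, rfl⟩ i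
      refine Fin.cases ?_ (fun i => ?_) i
      · simpa using hg
      · simpa using ht i
    · intro h
      exact ⟨t 0, h 0, Fin.tail t, fun i => h i.succ, Fin.cons_self_tail t⟩

theorem length_tuples {G : Type*} (k : ℕ) (l : List G) :
    (tuples k l).length = l.length ^ k := by
  induction k with
  | zero => simp [tuples]
  | succ k ih => simp [tuples, List.length_flatMap, ih, pow_succ, mul_comm]

/-- A rational vector as a real one. -/
def realVec {n : ℕ} (v : Fin n → ℚ) : Fin n → ℝ := fun i => (v i : ℝ)

theorem realVec_injective {n : ℕ} : Function.Injective (realVec (n := n)) := fun _ _ h =>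
  funext fun i => Rat.cast_injective (congrFun h i)

theorem realVec_dotProduct {n : ℕ} (v w : Fin n → ℚ) :
    realVec v ⬝ᵥ realVec w = ((v ⬝ᵥ w : ℚ) : ℝ) := by
  simp [dotProduct, realVec]

section Enumeration

variable {d : ℕ}

theorem realVec_liftPoint (y : Fin d → ℚ) : realVec (liftPoint y) = liftPoint (realVec y) := by
  ext j; refine Fin.cases ?_ (fun j => ?_) j <;> simp [realVec, liftPoint]

theorem realVec_liftAxis (i : Fin d) : realVec (liftAxis ℚ i) = liftAxis ℝ i := by
  ext j; refine Fin.cases ?_ (fun j => ?_) j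
  · simp [realVec, liftAxis]
  · simp only [realVec, liftAxis, Fin.cons_succ, Pi.single_apply]
    split <;> simp

theorem realVec_normalVec (t : Fin d → Fin (d + 1) → ℚ) :
    realVec (normalVec t) = normalVec fun k => realVec (t k) :=
  funext fun j => map_normalVec (Rat.castHom ℝ) t j

/-- The list of homogenized generators of `conv Y + ℝ^d_{≥0}`. -/
def genList (Y : List (Fin d → ℚ)) : List (Fin (d + 1) → ℚ) :=
  Y.map liftPoint ++ (List.finRange d).map (liftAxis ℚ)

/-- The normalized linear forms determined by `d` generators, valid or not. -/
def normalList (Y : List (Fin d → ℚ)) : List (Fin (d + 1) → ℚ) :=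
  (tuples d (genList Y)).map normalVec

/-- The normalized linear forms of all facets. -/
def facetList (Y : List (Fin d → ℚ)) : List (Fin (d + 1) → ℚ) :=
  (normalList Y).filter fun h =>
    (!decide (h = 0)) && (genList Y).all fun g => decide (0 ≤ h ⬝ᵥ g)

/-- The halfspace on which a homogenized linear form is nonnegative. -/
def formHalfspace (h : Fin (d + 1) → ℚ) : Set (Fin d → ℝ) :=
  halfspace (fun i => ((Fin.tail h i : ℚ) : ℝ)) ((-h 0 : ℚ) : ℝ)

theorem formHalfspace_eq (h : Fin (d + 1) → ℚ) :
    formHalfspace h = halfspace (Fin.tail (realVec h)) (-realVec h 0) := by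
  rw [formHalfspace, Rat.cast_neg]
  rfl

theorem gens_eq_genList (Y : List (Fin d → ℚ)) :
    gens (realVec '' {y | y ∈ Y}) = realVec '' {g | g ∈ genList Y} := by
  ext g
  constructor
  · rintro (⟨_, ⟨y, hy, rfl⟩, rfl⟩ | ⟨i, rfl⟩)
    · exact ⟨liftPoint y, List.mem_append_left _ (List.mem_map_of_mem hy), realVec_liftPoint y⟩
    · exact ⟨liftAxis ℚ i, List.mem_append_right _ (List.mem_map_of_mem (List.mem_finRange i)),
        realVec_liftAxis i⟩
  · rintro ⟨g, hg, rfl⟩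
    rcases List.mem_append.1 hg with hg | hg
    · obtain ⟨y, hy, rfl⟩ := List.mem_map.1 hg
      exact Or.inl ⟨realVec y, ⟨y, hy, rfl⟩, (realVec_liftPoint y).symm⟩
    · obtain ⟨i, -, rfl⟩ := List.mem_map.1 hg
      exact Or.inr ⟨i, (realVec_liftAxis i).symm⟩

theorem facetNormals_eq (Y : List (Fin d → ℚ)) :
    facetNormals (realVec '' {y | y ∈ Y}) = realVec '' {h | h ∈ facetList Y} := by
  have hval : ∀ h : Fin (d + 1) → ℚ, (∀ g ∈ gens (realVec '' {y | y ∈ Y}), 0 ≤ realVec h ⬝ᵥ g) ↔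
      ∀ g ∈ genList Y, 0 ≤ h ⬝ᵥ g := fun h => by
    rw [gens_eq_genList, Set.forall_mem_image]
    simp only [realVec_dotProduct, Rat.cast_nonneg]
    rfl
  have hzero : ∀ h : Fin (d + 1) → ℚ, realVec h = 0 ↔ h = 0 := fun h => by
    rw [← realVec_injective.eq_iff]
    have : realVec (0 : Fin (d + 1) → ℚ) = 0 := by ext; simp [realVec]
    rw [this]
  have hmem : ∀ h, h ∈ facetList Y ↔ h ∈ normalList Y ∧ h ≠ 0 ∧ ∀ g ∈ genList Y, 0 ≤ h ⬝ᵥ g :=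
    fun h => by simp [facetList]
  ext u
  constructor
  · rintro ⟨⟨t, ht, rfl⟩, h0, hv⟩
    rw [gens_eq_genList] at ht
    choose t' ht' htt using ht
    have heq : normalVec t = realVec (normalVec t') := by
      rw [realVec_normalVec]; congr 1; ext1 k; exact (htt k).symm
    rw [heq] at h0 hv ⊢
    exact ⟨_, (hmem _).2 ⟨List.mem_map_of_mem (mem_tuples.2 ht'), (hzero _).not.1 h0,
      (hval _).1 hv⟩, rfl⟩
  · rintro ⟨h, hh, rfl⟩
    obtain ⟨hn, h0, hv⟩ := (hmem h).1 hh
    obtain ⟨t, ht, rfl⟩ := List.mem_map.1 hn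
    refine ⟨⟨fun k => realVec (t k), fun k => ?_, realVec_normalVec t⟩, (hzero _).not.2 h0,
      (hval _).2 hv⟩
    rw [gens_eq_genList]
    exact ⟨_, mem_tuples.1 ht k, rfl⟩

theorem facetHalfspaces_eq_facetList {Y : List (Fin d → ℚ)} (hY : Y ≠ []) :
    facetHalfspaces (upperHull (realVec '' {y | y ∈ Y})) =
      formHalfspace '' {h | h ∈ facetList Y} := by
  rw [facetHalfspaces_upperHull (by simpa [Set.Nonempty] using List.exists_mem_of_ne_nil Y hY),
    facetNormals_eq, Set.image_image]
  simp only [formHalfspace_eq]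

theorem sum_of_mem_normalList {Y : List (Fin d → ℚ)} {h : Fin (d + 1) → ℚ}
    (hh : h ∈ normalList Y) (h0 : h ≠ 0) : ∑ i : Fin d, h i.succ = 1 := by
  obtain ⟨t, -, rfl⟩ := List.mem_map.1 hh
  exact sum_normalVec h0

theorem formHalfspace_injOn {h h' : Fin (d + 1) → ℚ} (hs : ∑ i : Fin d, h i.succ = 1)
    (hs' : ∑ i : Fin d, h' i.succ = 1) (heq : formHalfspace h = formHalfspace h') : h = h' := by
  rw [formHalfspace_eq, formHalfspace_eq] at heq
  refine realVec_injective (halfspace_injOn ?_ ?_ heq)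
  · simp only [realVec]; exact_mod_cast hs
  · simp only [realVec]; exact_mod_cast hs'

theorem mem_facetList_normal {Y : List (Fin d → ℚ)} {h : Fin (d + 1) → ℚ}
    (hh : h ∈ facetList Y) : h ∈ normalList Y ∧ h ≠ 0 := by
  simp [facetList] at hh
  exact ⟨hh.1, hh.2.1⟩

theorem normalList_subset {Y Y' : List (Fin d → ℚ)} (h : Y ⊆ Y') :
    normalList Y ⊆ normalList Y' := by
  intro u hu
  obtain ⟨t, ht, rfl⟩ := List.mem_map.1 hu
  refine List.mem_map_of_mem (mem_tuples.2 fun k => ?_)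
  rcases List.mem_append.1 (mem_tuples.1 ht k) with hk | hk
  · exact List.mem_append_left _ (List.map_subset _ h hk)
  · exact List.mem_append_right _ hk

theorem length_normalList (Y : List (Fin d → ℚ)) : (normalList Y).length = (Y.length + d) ^ d := by
  simp [normalList, length_tuples, genList]

/-- A halfspace that supports a facet is valid, and its normal vector is nonnegative. -/
theorem valid_of_mem_facetHalfspaces {Y : Set (Fin d → ℝ)} (hY : Y.Nonempty) {w : Fin d → ℝ}
    {c : ℝ} (h : halfspace w c ∈ facetHalfspaces (upperHull Y)) :
    0 ≤ w ∧ ∀ y ∈ Y, c ≤ ∑ i, w i * y i := by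
  obtain ⟨-, -, -, -, hsub, -⟩ := h
  obtain ⟨u, rfl, rfl⟩ : ∃ u : Fin (d + 1) → ℝ, w = Fin.tail u ∧ c = -u 0 :=
    ⟨Fin.cons (-c) w, by simp, by simp⟩
  have hval := (upperHull_subset_halfspace_iff hY).1 hsub
  exact ⟨succ_nonneg_of_valid hval, fun y hy =>
    hsub (mem_upperHull.2 ⟨y, subset_convexHull ℝ Y hy, le_rfl⟩)⟩

end Enumeration

/-! ### The number of iterations -/

/-- Vectors whose entries are zero or between `2^{-s}` and `2^s`, each of which exceeds each later
one by a factor of more than `1 + γ` in some entry: no two of them lie in the same cell of a grid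
with cells of ratio `1 + γ`, so their number is polynomial in `s` and `γ⁻¹`. -/
theorem List.length_le_of_pairwise_exceeds {ι : Type*} {d s : ℕ} {γ : ℝ} (hγ : 0 < γ) {L : List ι}
    {g : ι → Fin d → ℝ} (hL : L.Pairwise fun x x' => ∃ i, (1 + γ) * g x i < g x' i)
    (hg : ∀ x ∈ L, ∀ i, g x i = 0 ∨ ((2 : ℝ) ^ s)⁻¹ ≤ g x i ∧ g x i ≤ 2 ^ s) :
    L.length ≤ (2 * s * (⌈γ⁻¹⌉₊ + 1) + 2) ^ d := by
  classical
  set B := 2 * s * (⌈γ⁻¹⌉₊ + 1) + 2 with hB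
  have hlog : 0 < Real.log (1 + γ) := Real.log_pos (by linarith)
  have hlog' : (Real.log (1 + γ))⁻¹ ≤ γ⁻¹ + 1 := by
    rw [inv_le_comm₀ hlog (by positivity)]
    have := Real.one_sub_inv_le_log_of_pos (show 0 < 1 + γ by linarith)
    refine le_trans (le_of_eq ?_) this
    field_simp
    ring
  -- the position of a positive entry on the logarithmic scale
  set a : ℝ → ℝ := fun q => Real.log (q * 2 ^ s) / Real.log (1 + γ) with ha
  have ha0 : ∀ q, ((2 : ℝ) ^ s)⁻¹ ≤ q → 0 ≤ a q := fun q hq => by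
    refine div_nonneg (Real.log_nonneg ?_) hlog.le
    rwa [inv_le_iff_one_le_mul₀ (by positivity)] at hq
  have haB : ∀ q, ((2 : ℝ) ^ s)⁻¹ ≤ q → q ≤ 2 ^ s → ⌊a q⌋₊ + 1 < B := fun q hq hq' => by
    have h1 : Real.log (q * 2 ^ s) ≤ 2 * s := by
      have hq0 : 0 < q := lt_of_lt_of_le (by positivity) hq
      calc Real.log (q * 2 ^ s) ≤ Real.log (2 ^ s * 2 ^ s) :=
            Real.log_le_log (by positivity) (by gcongr)
        _ = 2 * s * Real.log 2 := by
            rw [← pow_add, Real.log_pow]; push_cast; ring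
        _ ≤ 2 * s * 1 := by
            gcongr
            linarith [Real.log_two_lt_d9]
        _ = 2 * s := mul_one _
    have h2 : a q ≤ 2 * s * (γ⁻¹ + 1) := by
      rw [ha]
      simp only [div_eq_mul_inv]
      gcongr
    have h3 : a q ≤ ((2 * s * (⌈γ⁻¹⌉₊ + 1) : ℕ) : ℝ) := by
      refine h2.trans ?_
      push_cast
      gcongr
      exact Nat.le_ceil _
    have := Nat.floor_le_floor h3
    rw [Nat.floor_natCast] at this
    omega
  set box : ι → Fin d → ℕ := fun x i => if g x i = 0 then 0 else ⌊a (g x i)⌋₊ + 1 with hbox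
  have hboxB : ∀ x ∈ L, ∀ i, box x i < B := fun x hx i => by
    simp only [hbox]
    split
    · omega
    · obtain ⟨h1, h2⟩ := (hg x hx i).resolve_left ‹_›
      exact haB _ h1 h2
  have hnodup : (L.map box).Nodup := by
    rw [List.Nodup, List.pairwise_map]
    refine hL.imp_of_mem ?_
    rintro x x' hx hx' ⟨i, hi⟩ heq
    have hi' := congrFun heq i
    have hpos : g x i = 0 ∨ 0 < g x i := (hg x hx i).imp id fun h =>
      lt_of_lt_of_le (by positivity) h.1
    have hx'0 : 0 < g x' i := lt_of_le_of_lt (mul_nonneg (by linarith)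
      (hpos.elim (fun h => h.ge) le_of_lt)) hi
    obtain ⟨h1', h2'⟩ := (hg x' hx' i).resolve_left hx'0.ne'
    simp only [hbox, if_neg hx'0.ne'] at hi'
    rcases hpos with h0 | h0
    · simp [h0] at hi'
    · obtain ⟨h1, h2⟩ := (hg x hx i).resolve_left h0.ne'
      rw [if_neg h0.ne'] at hi'
      have hgt : a (g x i) + 1 < a (g x' i) := by
        simp only [ha]
        rw [div_add_one hlog.ne', div_lt_div_iff_of_pos_right hlog, ← Real.log_mul
          (by positivity) (by linarith)]
        refine Real.log_lt_log (by positivity) ?_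
        calc g x i * 2 ^ s * (1 + γ) = (1 + γ) * g x i * 2 ^ s := by ring
          _ < g x' i * 2 ^ s := by gcongr
      have := Nat.floor_le_floor hgt.le
      rw [Nat.floor_add_one (ha0 _ h1)] at this
      omega
  have hsub : (L.map box).toFinset ⊆ Fintype.piFinset fun _ => Finset.range B := by
    intro b hb
    rw [List.mem_toFinset, List.mem_map] at hb
    obtain ⟨x, hx, rfl⟩ := hb
    simpa using hboxB x hx
  have := Finset.card_le_card hsub
  rw [List.toFinset_card_of_nodup hnodup] at this
  simpa using this

/-- A nonnegative rational number of encoding length `s` is zero or between `2^{-s}` and `2^s`. -/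
theorem bounds_of_encSize_le {q : ℚ} {s : ℕ} (hq : 0 ≤ q) (hs : encSize q ≤ s) :
    (q : ℝ) = 0 ∨ ((2 : ℝ) ^ s)⁻¹ ≤ q ∧ (q : ℝ) ≤ 2 ^ s := by
  rcases hq.eq_or_lt with rfl | hq
  · simp
  right
  rw [encSize_rat] at hs
  have hden : (q.den : ℝ) ≤ 2 ^ s := by
    have := (Nat.lt_size_self q.den).le.trans (Nat.pow_le_pow_right two_pos (by omega :
      q.den.size ≤ s))
    exact_mod_cast this
  have hnum : (q.num.natAbs : ℝ) ≤ 2 ^ s := by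
    have := (Nat.lt_size_self q.num.natAbs).le.trans (Nat.pow_le_pow_right two_pos (by omega :
      q.num.natAbs.size ≤ s))
    exact_mod_cast this
  have hnum0 := Rat.num_pos.2 hq
  have habs : (q.num : ℝ) = q.num.natAbs := by
    rw [Nat.cast_natAbs, abs_of_pos hnum0]
  have h1 : (1 : ℝ) ≤ q.num := by exact_mod_cast hnum0
  have hd1 : (1 : ℝ) ≤ q.den := by exact_mod_cast q.den_pos
  rw [Rat.cast_def]
  constructor
  · rw [inv_le_iff_one_le_mul₀ (by positivity), div_mul_eq_mul_div, le_div_iff₀ (by linarith)]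
    nlinarith
  · rw [div_le_iff₀ (by linarith), habs]
    nlinarith [show (0 : ℝ) < 2 ^ s by positivity]

theorem encSize_vec_apply_le {α : Type} [Enc α] {n : ℕ} (x : Fin n → α) (i : Fin n) :
    encSize (x i) ≤ encSize x := by
  have h : encSize x = encSize (List.ofFn x) := by
    simp only [encSize, Enc.enc, List.map_ofFn]
    rfl
  rw [h]
  exact encSize_le_of_mem (List.mem_ofFn.2 ⟨i, rfl⟩)

namespace MOMILP

variable {d : ℕ} (M : MOMILP d)

theorem f_real (x : M.Sol) : M.f (M.real x) = realVec (M.ratImage x) := by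
  ext i; simp [f, real, realVec, ratImage]

theorem innerApprox_eq (R : Set M.Sol) : M.innerApprox R = upperHull (M.images R) := rfl

theorem images_eq (R : Set M.Sol) : M.images R = (fun x => realVec (M.ratImage x)) '' R := by
  simp only [images, f_real]

theorem images_list (L : List M.Sol) :
    M.images {x | x ∈ L} = realVec '' {y | y ∈ L.map M.ratImage} := by
  rw [images_eq]
  ext z
  simp

/-- What the iteration count needs to know about an oracle: the solutions it returns are feasible,
have property `P`, and lie outside the given halfspace. -/
def IsSoundOracle (O : PlaneOracle M) (P : M.Sol → Prop) : Prop :=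
  ∀ (w : Fin d → ℚ) (c : ℚ) (x : M.Sol), 0 ≤ w → O w c (some x) →
    M.real x ∈ M.X ∧ P x ∧ ∑ i, w i * M.ratImage x i < c

/-- What the correctness proof needs to know about an oracle: when it answers "inside", the
halfspace contains the image set, up to the factor `κ`. -/
def IsApproxOracle (O : PlaneOracle M) (κ : ℝ) : Prop :=
  ∀ (w : Fin d → ℚ) (c : ℚ), 0 ≤ w → O w c none →
    ∀ x ∈ M.X, (c : ℝ) ≤ κ * ∑ i, (w i : ℝ) * M.f x i

end MOMILP

namespace InnerRun

variable {d : ℕ} {M : MOMILP d} {O : PlaneOracle M} {α : ℚ} {k : ℕ} {R : Set M.Sol}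
  {F : Set (Set (Fin d → ℝ))}

theorem nonneg_of_facet {R : Set M.Sol} (hR : R.Nonempty) {w : Fin d → ℚ} {c : ℚ}
    (h : halfspace (fun i => (w i : ℝ)) c ∈ facetHalfspaces (M.innerApprox R)) :
    0 ≤ w ∧ ∀ x ∈ R, c ≤ ∑ i, w i * M.ratImage x i := by
  obtain ⟨h1, h2⟩ := valid_of_mem_facetHalfspaces (hR.image _) h
  refine ⟨fun i => Rat.cast_nonneg.1 (h1 i), fun x hx => ?_⟩
  have := h2 _ ⟨x, hx, rfl⟩
  simp only [M.f_real, realVec] at this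
  exact_mod_cast this

theorem nonempty (h : InnerRun M O α k R F) : R.Nonempty := by
  induction h with
  | init _ => exact Set.singleton_nonempty _
  | not_inside _ _ _ _ => exact Set.insert_nonempty _ _
  | inside _ _ _ ih => exact ih

theorem finite (h : InnerRun M O α k R F) : R.Finite := by
  induction h with
  | init _ => exact Set.finite_singleton _
  | not_inside _ _ _ ih => exact ih.insert _
  | inside _ _ _ ih => exact ih

/-- In an execution, each solution improves on each earlier one by a factor of more than `α` in some
objective, and the finished halfspaces come from different tuples of generators. -/
theorem exists_lists (hα : 0 < α) {P : M.Sol → Prop} (hO : M.IsSoundOracle O P)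
    (h : InnerRun M O α k R F) :
    ∃ (L : List M.Sol) (x₀ : M.Sol) (N : List (Fin (d + 1) → ℚ)),
      R = {x | x ∈ L ++ [x₀]} ∧ F = formHalfspace '' {h | h ∈ N} ∧ k = L.length + N.length ∧
      (∀ x ∈ L, M.real x ∈ M.X ∧ P x) ∧ M.real x₀ ∈ M.X ∧
      L.Pairwise (fun x x' => ∃ i, α * M.ratImage x i < M.ratImage x' i) ∧
      N.Nodup ∧ N ⊆ normalList ((L ++ [x₀]).map M.ratImage) := by
  induction h with
  | @init x hx =>
    exact ⟨[], x, [], by ext; simp, by simp, rfl, by simp, hx, .nil, .nil, by simp⟩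
  | @not_inside k R F w c x hrun hfacet hx ih =>
    obtain ⟨L, x₀, N, rfl, rfl, rfl, hP, hx₀, hL, hN, hsub⟩ := ih
    obtain ⟨hw, hc⟩ := nonneg_of_facet hrun.nonempty hfacet.1
    obtain ⟨hX, hPx, hlt⟩ := hO _ _ _ (smul_nonneg hα.le hw) hx
    refine ⟨x :: L, x₀, N, ?_, rfl, by simp only [List.length_cons]; omega, ?_, hx₀, ?_, hN,
      fun _ hy => normalList_subset (by simp) (hsub hy)⟩
    · ext y; simp
    · intro y hy
      rcases List.mem_cons.1 hy with rfl | hy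
      · exact ⟨hX, hPx⟩
      · exact hP y hy
    · refine List.pairwise_cons.2 ⟨fun y hy => ?_, hL⟩
      have hsum := hlt.trans_le (hc y (List.mem_append_left _ hy))
      obtain ⟨i, -, hi⟩ := Finset.exists_lt_of_sum_lt hsum
      refine ⟨i, lt_of_mul_lt_mul_left (lt_of_eq_of_lt ?_ hi) (hw i)⟩
      rw [Pi.smul_apply, smul_eq_mul]
      ring
  | @inside k R F w c hrun hfacet hx ih =>
    obtain ⟨L, x₀, N, rfl, rfl, rfl, hP, hx₀, hL, hN, hsub⟩ := ih
    rw [M.innerApprox_eq, M.images_list, facetHalfspaces_eq_facetList (by simp)] at hfacet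
    obtain ⟨⟨h, hh, heq⟩, hnot⟩ := hfacet
    rw [← heq] at hnot ⊢
    refine ⟨L, x₀, h :: N, rfl, ?_, by simp only [List.length_cons]; omega, hP, hx₀, hL,
      List.nodup_cons.2 ⟨fun hmem => hnot ⟨h, hmem, rfl⟩, hN⟩,
      List.cons_subset.2 ⟨(mem_facetList_normal hh).1, hsub⟩⟩
    have : {a | a ∈ h :: N} = insert h {a | a ∈ N} := by ext; simp
    rw [this, Set.image_insert_eq]

/-- The number of iterations, when the images of the returned solutions have entries of encoding
length at most `s`. -/
theorem length_le {γ : ℚ} (hγ : 0 < γ) {s : ℕ} (hnonneg : ∀ x ∈ M.X, 0 ≤ M.f x)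
    (hO : M.IsSoundOracle O fun x => ∀ i, encSize (M.ratImage x i) ≤ s)
    (h : InnerRun M O (1 + γ) k R F) :
    k ≤ (2 * s * (⌈γ⁻¹⌉₊ + 1) + 2) ^ d + ((2 * s * (⌈γ⁻¹⌉₊ + 1) + 2) ^ d + 1 + d) ^ d := by
  obtain ⟨L, x₀, N, -, -, rfl, hP, -, hL, hN, hsub⟩ := h.exists_lists (by linarith) hO
  have hlen : L.length ≤ (2 * s * (⌈γ⁻¹⌉₊ + 1) + 2) ^ d := by
    have := List.length_le_of_pairwise_exceeds (γ := (γ : ℝ)) (s := s) (by exact_mod_cast hγ)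
      (g := fun x i => ((M.ratImage x i : ℚ) : ℝ)) (L := L)
      (hL.imp fun ⟨i, hi⟩ => ⟨i, by exact_mod_cast hi⟩) fun x hx i => by
        have h1 := hnonneg _ (hP x hx).1 i
        rw [M.f_real] at h1
        exact bounds_of_encSize_le (Rat.cast_nonneg.1 h1) ((hP x hx).2 i)
    rwa [← Rat.cast_inv, ← Int.ceil_toNat, Rat.ceil_cast, Int.ceil_toNat] at this
  have hN' := (hN.subperm hsub).length_le
  rw [length_normalList] at hN'
  refine add_le_add hlen (hN'.trans (Nat.pow_le_pow_left ?_ d))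
  simp
  omega

theorem smul_mem_of_mem {κ : ℝ} (hO : M.IsApproxOracle O κ) (hα : 0 < α)
    (h : InnerRun M O α k R F) : ∀ H ∈ F, ∀ x ∈ M.X, (α * κ : ℝ) • M.f x ∈ H := by
  induction h with
  | init _ => simp
  | not_inside _ _ _ ih => exact ih
  | @inside k R F w c hrun hfacet hx ih =>
    intro H hH x hxX
    rcases Set.mem_insert_iff.1 hH with rfl | hH
    · obtain ⟨hw, -⟩ := nonneg_of_facet hrun.nonempty hfacet.1
      have := hO _ _ (smul_nonneg hα.le hw) hx x hxX
      refine this.trans (le_of_eq ?_)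
      simp only [Pi.smul_apply, smul_eq_mul, Rat.cast_mul, Finset.mul_sum]
      exact Finset.sum_congr rfl fun i _ => by ring
    · exact ih H hH x hxX

theorem feasible (hα : 0 < α) {P : M.Sol → Prop} (hO : M.IsSoundOracle O P)
    (h : InnerRun M O α k R F) : ∀ x ∈ R, M.real x ∈ M.X := by
  obtain ⟨L, x₀, N, rfl, -, -, hP, hx₀, -⟩ := h.exists_lists hα hO
  intro x hx
  rcases List.mem_append.1 hx with hx | hx
  · exact (hP x hx).1
  · rwa [List.mem_singleton.1 hx]

end InnerRun

theorem InnerOutput.isConvexApprox {d : ℕ} {M : MOMILP d} {O : PlaneOracle M} {α : ℚ}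
    {R : Set M.Sol} {κ ρ : ℝ} (hα : 0 < α) (hnonneg : ∀ x ∈ M.X, 0 ≤ M.f x) {P : M.Sol → Prop}
    (hO : M.IsSoundOracle O P) (hO' : M.IsApproxOracle O κ) (hρ : α * κ ≤ ρ)
    (h : InnerOutput M O α R) : M.IsConvexApprox ρ R := by
  obtain ⟨k, F, hrun, hF⟩ := h
  refine ⟨hrun.feasible hα hO, fun x hx => ?_⟩
  have hmem : (α * κ : ℝ) • M.f x ∈ upperHull (M.images R) :=
    mem_upperHull_of_forall_facet (hrun.finite.image _) (hrun.nonempty.image _) fun H hH =>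
      hrun.smul_mem_of_mem hO' hα H (Set.sdiff_eq_empty.1 hF hH) x hx
  obtain ⟨v, hv, hvx⟩ := mem_upperHull.1 hmem
  exact ⟨v, hv, hvx.trans (smul_le_smul_of_nonneg_right hρ (hnonneg x hx))⟩

/-! ### The inner approximation algorithm as a program -/

section Subroutines

variable {α G : Type} [Enc α] [Enc G] {d : ℕ}

theorem polyTime_tuples (k : ℕ) : PolyTime (fun l : List G => tuples k l) := by
  induction k with
  | zero => exact .const _
  | succ k ih =>
    exact .flatMap (g := fun l g => (tuples k l).map fun t => Fin.cons g t) .id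
      (.map (g := fun x t => Fin.cons x.2 t) (ih.comp (.fst .id))
        (.vecCons (.snd (.fst .id)) (.snd .id)))

theorem polyTime_normalVec :
    PolyTime (fun t : Fin d → Fin (d + 1) → ℚ => normalVec t) := by
  have hcross : ∀ j, PolyTime (fun t : Fin d → Fin (d + 1) → ℚ => crossVec t j) := fun j => by
    refine .det fun i k => ?_
    refine Fin.cases ?_ (fun i => ?_) i
    · exact .const _
    · exact .apply (.apply .id i) k
  exact .vec fun j => .mul (.inv (.sum _ fun i _ => hcross _)) (hcross j)

theorem polyTime_genList : PolyTime (fun Y : List (Fin d → ℚ) => genList Y) :=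
  .append (.map (g := fun _ y => liftPoint y) .id (.vecCons (.const 1) (.snd .id))) (.const _)

theorem polyTime_normalList : PolyTime (fun Y : List (Fin d → ℚ) => normalList Y) :=
  .map (g := fun (_ : List (Fin d → ℚ)) t => normalVec t)
    ((polyTime_tuples d).comp polyTime_genList) (polyTime_normalVec.comp (.snd .id))

theorem polyTime_facetList : PolyTime (fun Y : List (Fin d → ℚ) => facetList Y) := by
  have hvalid : PolyTime (fun x : List (Fin d → ℚ) × (Fin (d + 1) → ℚ) =>
      (genList x.1).all fun g => decide (0 ≤ x.2 ⬝ᵥ g)) :=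
    .all (c := fun (x : List (Fin d → ℚ) × (Fin (d + 1) → ℚ)) g => decide (0 ≤ x.2 ⬝ᵥ g))
      (polyTime_genList.comp (.fst .id))
      (.le (.const 0) (.dotProduct (.snd (.fst .id)) (.snd .id)))
  have hzero : PolyTime (fun x : List (Fin d → ℚ) × (Fin (d + 1) → ℚ) => decide (x.2 = 0)) :=
    .eq (.snd .id) (.const 0)
  exact .filter (c := fun (Y : List (Fin d → ℚ)) h =>
    (!decide (h = 0)) && (genList Y).all fun g => decide (0 ≤ h ⬝ᵥ g))
    polyTime_normalList (.and hzero.not hvalid)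

end Subroutines

/-- The states of the program: instance and parameters `β`, `γ`; the solutions found so far with
their images; the linear forms of the finished halfspaces. -/
abbrev AlgState (d : ℕ) : Type :=
  (Val × ℚ × ℚ) × List (Val × (Fin d → ℚ)) × List (Fin (d + 1) → ℚ)

namespace AlgState

variable {d : ℕ}

/-- The linear forms of the unfinished facets. -/
def pending (σ : AlgState d) : List (Fin (d + 1) → ℚ) :=
  (facetList (σ.2.1.map Prod.snd)).filter fun h => σ.2.2.all fun h' => !decide (h' = h)

theorem polyTime_pending : PolyTime (fun σ : AlgState d => σ.pending) := by
  have hnew : PolyTime (fun x : AlgState d × (Fin (d + 1) → ℚ) =>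
      x.1.2.2.all fun h' => !decide (h' = x.2)) :=
    .all (c := fun (x : AlgState d × (Fin (d + 1) → ℚ)) h' => !decide (h' = x.2))
      (.snd (.snd (.fst .id))) (.not (.eq (.snd .id) (.snd (.fst .id))))
  have himages : PolyTime (fun σ : AlgState d => σ.2.1.map Prod.snd) :=
    .map (g := fun (_ : AlgState d) (x : Val × (Fin d → ℚ)) => x.2) (.fst (.snd .id))
      (.snd (.snd .id))
  exact .filter (c := fun (σ : AlgState d) h => σ.2.2.all fun h' => !decide (h' = h))
    (polyTime_facetList.comp himages) hnew

/-- The linear form of the facet that is treated next. -/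
def next (σ : AlgState d) : Fin (d + 1) → ℚ := σ.pending.headD 0

theorem polyTime_next : PolyTime (fun σ : AlgState d => σ.next) :=
  .headD (.const 0) polyTime_pending

/-- The weight with which the oracle is called next. -/
def weight (σ : AlgState d) : Fin d → ℚ := (1 + σ.1.2.2) • Fin.tail σ.next

theorem polyTime_weight : PolyTime (fun σ : AlgState d => σ.weight) :=
  .vec fun i => .mul (.add (.const 1) (.snd (.snd (.fst .id)))) (.apply polyTime_next.tail i)

/-- The state after the weighted sum program has returned the solution `x.1` with image `x.2`. -/
def update (σ : AlgState d) (x : Val × (Fin d → ℚ)) : AlgState d :=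
  if decide (-σ.next 0 ≤ σ.weight ⬝ᵥ x.2) then (σ.1, σ.2.1, σ.next :: σ.2.2)
  else (σ.1, x :: σ.2.1, σ.2.2)

theorem polyTime_update :
    PolyTime (fun z : AlgState d × Val × (Fin d → ℚ) => z.1.update z.2) :=
  .ite (.le (.neg (.apply (polyTime_next.comp (.fst .id)) 0))
      (.dotProduct (polyTime_weight.comp (.fst .id)) (.snd (.snd .id))))
    (.prodMk (.fst (.fst .id)) (.prodMk (.fst (.snd (.fst .id)))
      (.cons (polyTime_next.comp (.fst .id)) (.snd (.snd (.fst .id))))))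
    (.prodMk (.fst (.fst .id)) (.prodMk (.cons (.snd .id) (.fst (.snd (.fst .id))))
      (.snd (.snd (.fst .id)))))

end AlgState

/-- Calls the weighted sum program `WS` and evaluates the objectives of its answer by `E`. -/
def solveProg (WS E : Prog) : Prog :=
  .comp (.pair (.prim .snd) (.comp E (.pair (.comp (.prim .fst) (.prim .fst)) (.prim .snd))))
    (.pair (.prim .id) WS)

theorem Prog.RunsWithin.prim {o : Prim} {v u : Val} (h : o.eval v = u) :
    (Prog.prim o).RunsWithin v u (1 + v.size + u.size) :=
  ⟨_, h ▸ Runs.prim o v, le_rfl⟩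

theorem solveProg_runsWithin {WS E : Prog} {I u x y : Val} {s t : ℕ}
    (hWS : WS.RunsWithin (.pair I u) x s) (hE : E.RunsWithin (.pair I x) y t) :
    (solveProg WS E).RunsWithin (.pair I u) (.pair x y)
      (s + t + 10 * (Val.pair I u).size + 10 * x.size + 20) := by
  have h0 : (Prog.prim .id).RunsWithin (.pair I u) (.pair I u) _ := .prim rfl
  have h1 : (Prog.prim .snd).RunsWithin (.pair (.pair I u) x) x _ := .prim rfl
  have h2 : (Prog.prim .fst).RunsWithin (.pair (.pair I u) x) (.pair I u) _ := .prim rfl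
  have h3 : (Prog.prim .fst).RunsWithin (.pair I u) I _ := .prim rfl
  refine ((h1.pair (hE.comp ((h3.comp h2).pair h1))).comp (h0.pair hWS)).mono ?_
  simp only [Val.size]
  omega

/-! ### Polynomial bounds -/

/-- On `D`, the function `t` is bounded by a polynomial in the measure `m`. -/
def PolyBounded {ι : Type} (D : Set ι) (m t : ι → ℕ) : Prop :=
  ∃ p : Polynomial ℕ, ∀ s ∈ D, t s ≤ p.eval (m s)

namespace PolyBounded

variable {ι : Type} {D : Set ι} {m t t' : ι → ℕ}

theorem const (c : ℕ) : PolyBounded D m fun _ => c := ⟨.C c, fun s _ => by simp⟩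

theorem self : PolyBounded D m m := ⟨.X, fun s _ => by simp⟩

theorem add (h : PolyBounded D m t) (h' : PolyBounded D m t') :
    PolyBounded D m fun s => t s + t' s :=
  let ⟨p, hp⟩ := h; let ⟨q, hq⟩ := h'
  ⟨p + q, fun s hs => by simpa using add_le_add (hp s hs) (hq s hs)⟩

theorem mul (h : PolyBounded D m t) (h' : PolyBounded D m t') :
    PolyBounded D m fun s => t s * t' s :=
  let ⟨p, hp⟩ := h; let ⟨q, hq⟩ := h'
  ⟨p * q, fun s hs => by simpa using Nat.mul_le_mul (hp s hs) (hq s hs)⟩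

theorem pow (h : PolyBounded D m t) (n : ℕ) : PolyBounded D m fun s => t s ^ n :=
  let ⟨p, hp⟩ := h; ⟨p ^ n, fun s hs => by simpa using Nat.pow_le_pow_left (hp s hs) n⟩

theorem eval (q : Polynomial ℕ) (h : PolyBounded D m t) :
    PolyBounded D m fun s => q.eval (t s) :=
  let ⟨p, hp⟩ := h
  ⟨q.comp p, fun s hs => by simpa using q.eval_le_eval_nat (hp s hs)⟩

end PolyBounded

/-! ### The oracle built on the weighted sum program -/

section Oracle

variable {d : ℕ} {Pb : Problem d} {WS : Prog} {I : Val} {β : ℚ}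

/-- The answers of the oracle are determined by the weighted sum program, since programs are
deterministic. -/
theorem isSoundOracle_hpOWS {Q : (Pb.milp I).Sol → Prop}
    (h : ∀ w : Fin d → ℚ, 0 ≤ w → ∃ (x : (Pb.milp I).Sol) (t : ℕ),
      Runs WS (wsInput I w β) (encVec x) t ∧ IsApproxWS (Pb.milp I) w (1 + β) x ∧ Q x) :
    (Pb.milp I).IsSoundOracle (hpOWS Pb WS I β) Q := by
  intro w c x hw hx
  cases hx with
  | not_inside hrun hlt =>
    obtain ⟨x', t, hrun', happ, hQ⟩ := h w hw
    obtain rfl := encVec_injective (hrun.deterministic hrun')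
    exact ⟨happ.1, hQ, hlt⟩

theorem isApproxOracle_hpOWS
    (h : ∀ w : Fin d → ℚ, 0 ≤ w → ∃ (x : (Pb.milp I).Sol) (t : ℕ),
      Runs WS (wsInput I w β) (encVec x) t ∧ IsApproxWS (Pb.milp I) w (1 + β) x) :
    (Pb.milp I).IsApproxOracle (hpOWS Pb WS I β) (1 + β) := by
  intro w c hw hx x' hx'
  cases hx with
  | @inside _ _ x _ hrun hle =>
    obtain ⟨x'', t, hrun', happ⟩ := h w hw
    obtain rfl := encVec_injective (hrun.deterministic hrun')
    refine le_trans ?_ (happ.2 x' hx')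
    rw [(Pb.milp I).f_real]
    simp only [realVec]
    exact_mod_cast hle

theorem alwaysCorrect_of_isApproxWS {β γ : ℚ → ℚ} (hs : IsSplit β γ)
    (h : ∀ δ : ℚ, 0 < δ → ∀ I ∈ Pb.inst, ∀ w : Fin d → ℚ, 0 ≤ w →
      ∃ (x : (Pb.milp I).Sol) (t : ℕ), Runs WS (wsInput I w δ) (encVec x) t ∧
        IsApproxWS (Pb.milp I) w (1 + δ) x) :
    AlwaysCorrect Pb WS β γ := by
  intro ε hε I hI R hR
  obtain ⟨hβ, hγ, hβγ⟩ := hs ε hε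
  refine hR.isConvexApprox (κ := 1 + β ε) (P := fun _ => True) (by linarith) (Pb.nonneg I hI)
    (isSoundOracle_hpOWS fun w hw => ?_) (isApproxOracle_hpOWS (h _ hβ I hI)) ?_
  · obtain ⟨x, t, h1, h2⟩ := h _ hβ I hI w hw
    exact ⟨x, t, h1, h2, trivial⟩
  · rw [mul_comm]
    exact_mod_cast hβγ

end Oracle

/-- Inputs `s = (I, ε)` from `D` on which the programs `WS` and `S` run in time polynomial in a
measure `m s` of the input. For schemes that are polynomial for each fixed accuracy, `D` fixes the
accuracy; for fully polynomial schemes, `D` consists of all inputs. -/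
structure IsRegime {d : ℕ} (Pb : Problem d) (WS S : Prog) (β γ : ℚ → ℚ) (D : Set (Val × ℚ))
    (m : Val × ℚ → ℕ) (p : Polynomial ℕ) : Prop where
  mem : ∀ s ∈ D, s.1 ∈ Pb.inst
  pos : ∀ s ∈ D, 0 < γ s.2
  size_le : ∀ s ∈ D, s.1.size ≤ p.eval (m s) ∧ encSize s.2 ≤ p.eval (m s)
  inv_le : ∀ s ∈ D, ⌈(γ s.2)⁻¹⌉₊ ≤ p.eval (m s)
  split : ∀ s ∈ D, S.RunsWithin (.num s.2) (.pair (.num (β s.2)) (.num (γ s.2))) (p.eval (m s))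
  solve : ∀ s ∈ D, ∀ w : Fin d → ℚ, 0 ≤ w → ∃ x : (Pb.milp s.1).Sol,
    WS.RunsWithin (wsInput s.1 w (β s.2)) (encVec x) (p.eval (m s + (encVec w).size)) ∧
      IsApproxWS (Pb.milp s.1) w (1 + β s.2) x ∧ (encVec x).size ≤ p.eval (m s)

/-- `E` evaluates the objective function of the instance `I` within the time bound `p`. -/
def Evaluates {d : ℕ} (Pb : Problem d) (E : Prog) (p : Polynomial ℕ) : Prop :=
  ∀ I ∈ Pb.inst, ∀ x : (Pb.milp I).Sol, (Pb.milp I).real x ∈ (Pb.milp I).X →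
    E.RunsWithin (.pair I (encVec x)) (encVec ((Pb.milp I).ratImage x))
      (p.eval (I.size + (encVec x).size))

namespace IsRegime

variable {d : ℕ} {Pb : Problem d} {WS S E : Prog} {β γ : ℚ → ℚ} {D : Set (Val × ℚ)}
  {m : Val × ℚ → ℕ} {p pE : Polynomial ℕ}

theorem polyBounded_eval (_ : IsRegime Pb WS S β γ D m p) :
    PolyBounded D m fun s => p.eval (m s) := ⟨p, fun _ _ => le_rfl⟩

/-- The solutions returned are short, and so are their images, since the latter can be computed in
polynomial time. -/
theorem isSoundOracle (h : IsRegime Pb WS S β γ D m p) (hE : Evaluates Pb E pE)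
    {s : Val × ℚ} (hs : s ∈ D) :
    (Pb.milp s.1).IsSoundOracle (hpOWS Pb WS s.1 (β s.2)) fun x =>
      ∀ i, encSize ((Pb.milp s.1).ratImage x i) ≤ pE.eval (p.eval (m s) + p.eval (m s)) := by
  refine isSoundOracle_hpOWS fun w hw => ?_
  obtain ⟨x, ⟨t, ht, -⟩, happ, hx⟩ := h.solve s hs w hw
  refine ⟨x, t, ht, happ, fun i => ?_⟩
  refine (encSize_vec_apply_le _ i).trans ((hE s.1 (h.mem s hs) x happ.1).size_le.trans ?_)
  exact pE.eval_le_eval_nat (add_le_add (h.size_le s hs).1 hx)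

/-- A bound on the number of iterations. -/
def iterBound (d : ℕ) (m : Val × ℚ → ℕ) (p pE : Polynomial ℕ) (s : Val × ℚ) : ℕ :=
  (2 * pE.eval (p.eval (m s) + p.eval (m s)) * (p.eval (m s) + 1) + 2) ^ d +
    ((2 * pE.eval (p.eval (m s) + p.eval (m s)) * (p.eval (m s) + 1) + 2) ^ d + 1 + d) ^ d

theorem le_iterBound (h : IsRegime Pb WS S β γ D m p) (hE : Evaluates Pb E pE)
    {s : Val × ℚ} (hs : s ∈ D) {k : ℕ} {R : Set (Pb.milp s.1).Sol} {F : Set (Set (Fin d → ℝ))}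
    (hrun : InnerRun (Pb.milp s.1) (hpOWS Pb WS s.1 (β s.2)) (1 + γ s.2) k R F) :
    k ≤ iterBound d m p pE s := by
  refine (hrun.length_le (h.pos s hs) (Pb.nonneg _ (h.mem s hs)) (h.isSoundOracle hE hs)).trans ?_
  have := h.inv_le s hs
  unfold iterBound
  gcongr

theorem polyBounded_iterBound (h : IsRegime Pb WS S β γ D m p) :
    PolyBounded D m (iterBound d m p pE) := by
  have hp := h.polyBounded_eval
  have hb := ((((PolyBounded.const 2).mul ((hp.add hp).eval pE)).mul (hp.add (.const 1))).add
    (.const 2)).pow d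
  exact hb.add (((hb.add (.const 1)).add (.const d)).pow d)

end IsRegime

/-! ### States of the program -/

section Simulation

variable {d : ℕ}

theorem encSize_vec_le {α : Type} [Enc α] {n : ℕ} (x : Fin n → α) {B : ℕ}
    (h : ∀ i, encSize (x i) ≤ B) : encSize x ≤ 1 + n * (B + 1) := by
  have he : encSize x = encSize (List.ofFn x) := by
    simp only [encSize, Enc.enc, List.map_ofFn]
    rfl
  have := encSize_le_of_forall_le (l := List.ofFn x) (B := B) fun a ha => by
    obtain ⟨i, rfl⟩ := List.mem_ofFn.1 ha
    exact h i
  rwa [List.length_ofFn, ← he] at this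

/-- The linear forms of facets are determined by `d` generators, so their encoding length does not
depend on the number of generators. -/
theorem exists_encSize_normalList_le (d : ℕ) : ∃ q : Polynomial ℕ, ∀ (Y : List (Fin d → ℚ)) (B : ℕ),
    (∀ y ∈ Y, encSize y ≤ B) → ∀ h ∈ normalList Y, encSize h ≤ q.eval B := by
  obtain ⟨q, hq⟩ := (polyTime_normalVec (d := d)).encSize_le
  set c := ∑ i : Fin d, encSize (liftAxis ℚ i) with hc
  refine ⟨q.comp (1 + .C d * (.X + .C c + 5)), fun Y B hY h hh => ?_⟩
  obtain ⟨t, ht, rfl⟩ := List.mem_map.1 hh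
  refine (hq t).trans ?_
  rw [Polynomial.eval_comp]
  refine q.eval_le_eval_nat ?_
  have := encSize_vec_le t (B := B + c + 4) fun k => by
    rcases List.mem_append.1 (mem_tuples.1 ht k) with hk | hk
    · obtain ⟨y, hy, hyk⟩ := List.mem_map.1 hk
      rw [← hyk, liftPoint, encSize, enc_vecCons]
      have := hY y hy
      simp only [Val.size, encSize] at *
      simp [Enc.enc, Val.size] at *
      omega
    · obtain ⟨i, -, hik⟩ := List.mem_map.1 hk
      have : encSize (liftAxis ℚ i) ≤ c :=
        Finset.single_le_sum (f := fun i => encSize (liftAxis ℚ i)) (fun _ _ => Nat.zero_le _)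
          (Finset.mem_univ i)
      rw [← hik]
      omega
  refine this.trans ?_
  simp [add_assoc]

variable (Pb : Problem d) (I : Val) (b c : ℚ)

/-- The state of the program after the solutions `L` and the linear forms `N` have been found. -/
def algState (L : List (Pb.milp I).Sol) (N : List (Fin (d + 1) → ℚ)) : AlgState d :=
  ((I, b, c), L.map fun x => (encVec x, (Pb.milp I).ratImage x), N)

variable {Pb I b c}

theorem facetHalfspaces_list {L : List (Pb.milp I).Sol} (hL : L ≠ []) :
    facetHalfspaces ((Pb.milp I).innerApprox {x | x ∈ L}) =
      formHalfspace '' {h | h ∈ facetList (L.map (Pb.milp I).ratImage)} := by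
  rw [MOMILP.innerApprox_eq, MOMILP.images_list, facetHalfspaces_eq_facetList (by simpa using hL)]

theorem mem_pending_algState {L : List (Pb.milp I).Sol} {N : List (Fin (d + 1) → ℚ)}
    {h : Fin (d + 1) → ℚ} :
    h ∈ (algState Pb I b c L N).pending ↔
      h ∈ facetList (L.map (Pb.milp I).ratImage) ∧ h ∉ N := by
  simp only [AlgState.pending, algState, List.map_map, List.mem_filter, List.all_eq_true,
    Bool.not_eq_true', decide_eq_false_iff_not]
  refine and_congr Iff.rfl ⟨fun hN hmem => hN h hmem rfl, fun hN h' hmem heq => hN (heq ▸ hmem)⟩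

end Simulation

/-! ### Executions of the program -/

section Execution

variable {d : ℕ}

theorem InnerRun.feasible_of_isRegime {Pb : Problem d} {WS S E : Prog} {β γ : ℚ → ℚ}
    {D : Set (Val × ℚ)} {m : Val × ℚ → ℕ} {p pE : Polynomial ℕ}
    (h : IsRegime Pb WS S β γ D m p) (hE : Evaluates Pb E pE) {s : Val × ℚ} (hs : s ∈ D) {k : ℕ}
    {R : Set (Pb.milp s.1).Sol} {F : Set (Set (Fin d → ℝ))}
    (hrun : InnerRun (Pb.milp s.1) (hpOWS Pb WS s.1 (β s.2)) (1 + γ s.2) k R F) :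
    ∀ x ∈ R, (Pb.milp s.1).real x ∈ (Pb.milp s.1).X :=
  hrun.feasible (by linarith [h.pos s hs]) (h.isSoundOracle hE hs)

/-- The lists `L` of solutions and `N` of linear forms represent the sets of an execution after `k`
iterations. The solutions have encoding length at most `a`, and the forms at most `e`. -/
structure Represents (Pb : Problem d) (WS : Prog) (I : Val) (b c : ℚ) (a e k : ℕ)
    (L : List (Pb.milp I).Sol) (N : List (Fin (d + 1) → ℚ)) : Prop where
  run : InnerRun (Pb.milp I) (hpOWS Pb WS I b) (1 + c) k {x | x ∈ L} (formHalfspace '' {h | h ∈ N})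
  length : L.length + N.length = k + 1
  short : ∀ x ∈ L, (encVec x).size ≤ a
  normal : ∀ h ∈ N, ∑ i : Fin d, h i.succ = 1
  encSize_le : ∀ h ∈ N, encSize h ≤ e

namespace Represents

variable {Pb : Problem d} {WS : Prog} {I : Val} {b c : ℚ} {a e k : ℕ}
  {L : List (Pb.milp I).Sol} {N : List (Fin (d + 1) → ℚ)}

theorem ne_nil (h : Represents Pb WS I b c a e k L N) : L ≠ [] := by
  obtain ⟨x, hx⟩ := h.run.nonempty
  exact List.ne_nil_of_mem hx

/-- When no facet is pending, the execution has terminated. -/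
theorem innerOutput (h : Represents Pb WS I b c a e k L N)
    (hp : (algState Pb I b c L N).pending = []) :
    InnerOutput (Pb.milp I) (hpOWS Pb WS I b) (1 + c) {x | x ∈ L} := by
  refine ⟨k, _, h.run, ?_⟩
  rw [facetHalfspaces_list h.ne_nil, Set.sdiff_eq_empty]
  rintro _ ⟨u, hu, rfl⟩
  by_contra hnot
  have : u ∈ (algState Pb I b c L N).pending :=
    mem_pending_algState.2 ⟨hu, fun hN => hnot ⟨u, hN, rfl⟩⟩
  rw [hp] at this
  simp at this

theorem next_mem (hp : (algState Pb I b c L N).pending ≠ []) :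
    (algState Pb I b c L N).next ∈ facetList (L.map (Pb.milp I).ratImage) ∧
      (algState Pb I b c L N).next ∉ N := by
  rw [← mem_pending_algState, AlgState.next]
  cases hc : (algState Pb I b c L N).pending with
  | nil => exact absurd hc hp
  | cons u l => simp

theorem facet_next (h : Represents Pb WS I b c a e k L N)
    (hp : (algState Pb I b c L N).pending ≠ []) :
    formHalfspace (algState Pb I b c L N).next ∈
      facetHalfspaces ((Pb.milp I).innerApprox {x | x ∈ L}) \ (formHalfspace '' {h | h ∈ N}) := by
  obtain ⟨hmem, hN⟩ := next_mem hp
  refine ⟨by rw [facetHalfspaces_list h.ne_nil]; exact ⟨_, hmem, rfl⟩, ?_⟩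
  rintro ⟨u, hu, heq⟩
  obtain ⟨hn, h0⟩ := mem_facetList_normal hmem
  -- distinct normalized forms give distinct halfspaces
  rw [formHalfspace_injOn (h.normal u hu) (sum_of_mem_normalList hn h0) heq] at hu
  exact hN hu

theorem weight_nonneg (h : Represents Pb WS I b c a e k L N) (hc : 0 < c)
    (hp : (algState Pb I b c L N).pending ≠ []) : 0 ≤ (algState Pb I b c L N).weight :=
  smul_nonneg (by change 0 ≤ 1 + c; linarith)
    (InnerRun.nonneg_of_facet h.run.nonempty (h.facet_next hp).1).1

/-- One execution of the loop body is one iteration of the algorithm. -/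
theorem step (h : Represents Pb WS I b c a e k L N)
    (hp : (algState Pb I b c L N).pending ≠ []) {x : (Pb.milp I).Sol} {t : ℕ}
    (hx : Runs WS (wsInput I (algState Pb I b c L N).weight b) (encVec x) t)
    (hxa : (encVec x).size ≤ a) (he : encSize (algState Pb I b c L N).next ≤ e) :
    ∃ L' N', (algState Pb I b c L N).update (encVec x, (Pb.milp I).ratImage x) =
        algState Pb I b c L' N' ∧ Represents Pb WS I b c a e (k + 1) L' N' := by
  have hfacet := h.facet_next hp
  obtain ⟨hmem, -⟩ := next_mem hp
  obtain ⟨hn, h0⟩ := mem_facetList_normal hmem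
  have hsum := sum_of_mem_normalList hn h0
  have hlen := h.length
  set σ := algState Pb I b c L N
  by_cases hle : -σ.next 0 ≤ σ.weight ⬝ᵥ (Pb.milp I).ratImage x
  · refine ⟨L, σ.next :: N, ?_, ?_, ?_, h.short, ?_, ?_⟩
    · simp only [AlgState.update, hle, decide_true, if_true]
      rfl
    · have hset : {u | u ∈ σ.next :: N} = insert σ.next {u | u ∈ N} := by ext; simp
      rw [hset, Set.image_insert_eq]
      exact .inside h.run hfacet (.inside hx hle)
    · rw [List.length_cons]; omega
    · exact List.forall_mem_cons.2 ⟨hsum, h.normal⟩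
    · exact List.forall_mem_cons.2 ⟨he, h.encSize_le⟩
  · refine ⟨x :: L, N, ?_, ?_, ?_, ?_, h.normal, h.encSize_le⟩
    · simp only [AlgState.update, hle, decide_false, Bool.false_eq_true, if_false]
      rfl
    · have hset : {u | u ∈ x :: L} = insert x {u | u ∈ L} := by ext; simp
      rw [hset]
      exact .not_inside h.run hfacet (.not_inside hx (not_le.1 hle))
    · rw [List.length_cons]; omega
    · exact List.forall_mem_cons.2 ⟨hxa, h.short⟩

theorem encSize_algState_le (h : Represents Pb WS I b c a e k L N) {K g n : ℕ} (hk : k ≤ K)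
    (hg : ∀ x ∈ L, encSize ((Pb.milp I).ratImage x) ≤ g) (hI : I.size ≤ n)
    (hbc : encSize (b, c) ≤ n) :
    encSize (algState Pb I b c L N) ≤ 5 + 2 * n + (K + 1) * (a + g + 2) + (K + 1) * (e + 1) := by
  have hL : encSize (L.map fun x => (encVec x, (Pb.milp I).ratImage x)) ≤
      1 + (K + 1) * (a + g + 2) := by
    refine (encSize_le_of_forall_le (B := a + g + 1) ?_).trans ?_
    · intro z hz
      obtain ⟨x, hx, rfl⟩ := List.mem_map.1 hz
      have h1 := h.short x hx
      have h2 := hg x hx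
      rw [encSize_prod]
      simp only [encSize, Enc.enc, id] at *
      omega
    · rw [List.length_map]
      have : L.length ≤ K + 1 := by have := h.length; omega
      gcongr
  have hN : encSize N ≤ 1 + (K + 1) * (e + 1) := by
    refine (encSize_le_of_forall_le h.encSize_le).trans ?_
    have : N.length ≤ K + 1 := by have := h.length; omega
    gcongr
  have hI' : encSize I ≤ n := hI
  rw [encSize_mk] at hbc
  rw [algState, encSize_mk, encSize_mk, encSize_mk, encSize_mk]
  omega

end Represents

/-- The inner approximation algorithm, with the facets found by enumeration, is a program that
carries out an execution of the algorithm in polynomial time. -/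
theorem exists_program (Pb : Problem d) (WS S E : Prog) {pE : Polynomial ℕ}
    (hE : Evaluates Pb E pE) :
    ∃ P : Prog, ∀ (β γ : ℚ → ℚ) (D : Set (Val × ℚ)) (m : Val × ℚ → ℕ) (p : Polynomial ℕ),
      IsRegime Pb WS S β γ D m p → ∃ q : Polynomial ℕ, ∀ s ∈ D, ∃ L : List (Pb.milp s.1).Sol,
        P.RunsWithin (.pair s.1 (.num s.2)) (encVecs L) (q.eval (m s)) ∧
        InnerOutput (Pb.milp s.1) (hpOWS Pb WS s.1 (β s.2)) (1 + γ s.2) {x | x ∈ L} := by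
  have hfirst : PolyTime (fun z : Val × ℚ × ℚ => (z.1, (0 : Fin d → ℚ), z.2.1)) :=
    .prodMk (.fst .id) (.prodMk (.const 0) (.fst (.snd .id)))
  have hinit : PolyTime (fun z : (Val × ℚ × ℚ) × (Val × (Fin d → ℚ)) =>
      ((z.1, [z.2], []) : AlgState d)) :=
    .prodMk (.fst .id) (.prodMk (.cons (.snd .id) (.const [])) (.const []))
  have hcond : PolyTime (fun σ : AlgState d => !σ.pending.isEmpty) :=
    (AlgState.polyTime_pending.isEmpty).not
  have hquery : PolyTime (fun σ : AlgState d => (σ.1.1, σ.weight, σ.1.2.1)) :=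
    .prodMk (.fst (.fst .id)) (.prodMk AlgState.polyTime_weight (.fst (.snd (.fst .id))))
  have houtput : PolyTime (fun σ : AlgState d => σ.2.1.map Prod.fst) :=
    .map (g := fun (_ : AlgState d) (x : Val × (Fin d → ℚ)) => x.1) (.fst (.snd .id))
      (.fst (.snd .id))
  obtain ⟨Pf, pf, hPf⟩ := hfirst
  obtain ⟨Pi, pi, hPi⟩ := hinit
  obtain ⟨Pc, pc, hPc⟩ := hcond
  obtain ⟨Pq, pq, hPq⟩ := hquery
  obtain ⟨Pu, pu, hPu⟩ := AlgState.polyTime_update (d := d)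
  obtain ⟨Po, po, hPo⟩ := houtput
  obtain ⟨pn, hpn⟩ := exists_encSize_normalList_le d
  set body : Prog := .comp Pu (.pair (.prim .id) (.comp (solveProg WS E) Pq))
  set start : Prog := .comp Pi (.pair (.prim .id) (.comp (solveProg WS E) Pf))
  set params : Prog := .pair (.prim .fst) (.comp S (.prim .snd))
  refine ⟨.comp Po (.comp (.loop Pc body) (.comp start params)), fun β γ D m p h => ?_⟩
  -- bounds for an input `s`: `a s` for the given data and the solutions, `g s` for the evaluation
  -- of the objectives, `e s` for the linear forms, `K s` for the number of iterations, `Z s` for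
  -- the states
  let a : Val × ℚ → ℕ := fun s => p.eval (m s)
  let g : Val × ℚ → ℕ := fun s => pE.eval (a s + a s)
  let e : Val × ℚ → ℕ := fun s => pn.eval (g s)
  let K : Val × ℚ → ℕ := IsRegime.iterBound d m p pE
  let Z : Val × ℚ → ℕ := fun s =>
    5 + 2 * a s + (K s + 1) * (a s + g s + 2) + (K s + 1) * (e s + 1)
  -- the time of a call of the weighted sum program on a query of length `u s`
  let W : (Val × ℚ → ℕ) → Val × ℚ → ℕ := fun u s =>
    p.eval (m s + u s) + g s + 10 * u s + 10 * a s + 20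
  let T : Val × ℚ → ℕ := fun s => pc.eval (Z s) + (pq.eval (Z s) + W (fun s => pq.eval (Z s)) s +
    pu.eval (2 + Z s + a s + g s) + 2 * Z s + 10)
  let z₀ : Val × ℚ → ℕ := fun s => 1 + a s + a s
  let T₀ : Val × ℚ → ℕ := fun s => pf.eval (z₀ s) + W (fun s => pf.eval (z₀ s)) s +
    pi.eval (2 + z₀ s + a s + g s) + 2 * z₀ s + 10
  have ha : PolyBounded D m a := h.polyBounded_eval
  have hg : PolyBounded D m g := (ha.add ha).eval pE
  have he : PolyBounded D m e := hg.eval pn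
  have hKb : PolyBounded D m K := h.polyBounded_iterBound
  have hZ : PolyBounded D m Z := (((PolyBounded.const 5).add ((PolyBounded.const 2).mul ha)).add
    ((hKb.add (.const 1)).mul ((ha.add hg).add (.const 2)))).add
    ((hKb.add (.const 1)).mul (he.add (.const 1)))
  have hW : ∀ {u}, PolyBounded D m u → PolyBounded D m (W u) := fun {u} hu =>
    (((((PolyBounded.self.add hu).eval p).add hg).add ((PolyBounded.const 10).mul hu)).add
      ((PolyBounded.const 10).mul ha)).add (.const 20)
  have hT : PolyBounded D m T := (hZ.eval pc).add (((((hZ.eval pq).add (hW (hZ.eval pq))).add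
    (((((PolyBounded.const 2).add hZ).add ha).add hg).eval pu)).add
      ((PolyBounded.const 2).mul hZ)).add (.const 10))
  have hz₀ : PolyBounded D m z₀ := ((PolyBounded.const 1).add ha).add ha
  have hT₀ : PolyBounded D m T₀ := ((((hz₀.eval pf).add (hW (hz₀.eval pf))).add
    (((((PolyBounded.const 2).add hz₀).add ha).add hg).eval pi)).add
      ((PolyBounded.const 2).mul hz₀)).add (.const 10)
  have htotal : PolyBounded D m fun s => (7 * a s + 10) + T₀ s + (K s + 1) * (2 * T s + 1) +
      po.eval (Z s) + 3 :=
    (((((((PolyBounded.const 7).mul ha).add (.const 10)).add hT₀).add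
      ((hKb.add (.const 1)).mul (((PolyBounded.const 2).mul hT).add (.const 1)))).add
        (hZ.eval po)).add (.const 3))
  obtain ⟨q, hq⟩ := htotal
  refine ⟨q, fun s hs => ?_⟩
  have hsplit := h.split s hs
  have hsize := h.size_le s hs
  have hc := h.pos s hs
  set I := s.1
  set b := β s.2
  set c := γ s.2
  have hbc : encSize (b, c) ≤ a s := hsplit.size_le
  have himage : ∀ x : (Pb.milp I).Sol, (Pb.milp I).real x ∈ (Pb.milp I).X →
      (encVec x).size ≤ a s → E.RunsWithin (.pair I (encVec x))
        (encVec ((Pb.milp I).ratImage x)) (g s) := fun x hx hxa =>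
    (hE I (h.mem s hs) x hx).mono (pE.eval_le_eval_nat (add_le_add hsize.1 hxa))
  -- a call of the weighted sum program
  have hcall : ∀ (w : Fin d → ℚ) (u : Val × ℚ → ℕ), 0 ≤ w → encSize (I, w, b) ≤ u s →
      ∃ (x : (Pb.milp I).Sol) (t : ℕ), Runs WS (wsInput I w b) (encVec x) t ∧
        (Pb.milp I).real x ∈ (Pb.milp I).X ∧ (encVec x).size ≤ a s ∧
        encSize ((Pb.milp I).ratImage x) ≤ g s ∧
        (solveProg WS E).RunsWithin (Enc.enc (I, w, b))
          (Enc.enc (encVec x, (Pb.milp I).ratImage x)) (W u s) := by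
    intro w u hw hu
    obtain ⟨x, hrun, happ, hxa⟩ := h.solve s hs w hw
    change _ ≤ a s at hxa
    have hEx := himage x happ.1 hxa
    obtain ⟨t, ht, -⟩ := id hrun
    refine ⟨x, t, ht, happ.1, hxa, hEx.size_le, (solveProg_runsWithin hrun hEx).mono ?_⟩
    have h0 : (Val.pair s.1 (.pair (encVec w) (.num (β s.2)))).size ≤ u s := hu
    have h1 := h0
    have h2 : p.eval (m s + (encVec w).size) ≤ p.eval (m s + u s) := by
      refine p.eval_le_eval_nat ?_
      simp only [Val.size] at h1
      omega
    simp only [W]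
    omega
  -- the states that the loop passes through
  let Inv : ℕ → Val → Prop := fun k v => ∃ L N,
    Represents Pb WS I b c (a s) (e s) k L N ∧ v = Enc.enc (algState Pb I b c L N)
  let Done : ℕ → Val → Prop := fun k v => ∃ L N,
    Represents Pb WS I b c (a s) (e s) k L N ∧ (algState Pb I b c L N).pending = [] ∧
      v = Enc.enc (algState Pb I b c L N)
  have hInvK : ∀ k L N, Represents Pb WS I b c (a s) (e s) k L N → k ≤ K s := fun k L N hr =>
    h.le_iterBound hE hs hr.run
  have hInvg : ∀ {k L N}, Represents Pb WS I b c (a s) (e s) k L N → ∀ x ∈ L,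
      encSize ((Pb.milp I).ratImage x) ≤ g s := fun {k L N} hr x hx =>
    (himage x (hr.run.feasible_of_isRegime h hE hs x hx) (hr.short x hx)).size_le
  have hInvZ : ∀ {k L N}, Represents Pb WS I b c (a s) (e s) k L N →
      encSize (algState Pb I b c L N) ≤ Z s := fun {k L N} hr =>
    hr.encSize_algState_le (hInvK k L N hr) (hInvg hr) hsize.1 hbc
  have hstep : ∀ k v, Inv k v → (Done k v ∧ Pc.RunsWithin v (.num 0) (T s)) ∨
      ∃ u w, u ≠ .num 0 ∧ Pc.RunsWithin v u (T s) ∧ body.RunsWithin v w (T s) ∧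
        Inv (k + 1) w := by
    rintro k v ⟨L, N, hr, rfl⟩
    have hσZ := hInvZ hr
    have hfeas := hInvg hr
    set σ := algState Pb I b c L N
    have hcσ := (hPc σ).mono ((pc.eval_le_eval_nat hσZ).trans (Nat.le_add_right _ _ : _ ≤ T s))
    by_cases hp : σ.pending = []
    · left
      refine ⟨⟨L, N, hr, hp, rfl⟩, ?_⟩
      simpa [hp, Enc.enc] using hcσ
    · right
      have hqσ := hPq σ
      have hqu : encSize (I, σ.weight, b) ≤ pq.eval (Z s) :=
        hqσ.size_le.trans (pq.eval_le_eval_nat hσZ)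
      obtain ⟨x, t, ht, -, hxa, hxg, hcallx⟩ := hcall σ.weight (fun s => pq.eval (Z s))
        (hr.weight_nonneg hc hp) hqu
      have hnext : encSize σ.next ≤ e s := by
        refine hpn _ (g s) ?_ σ.next (mem_facetList_normal (Represents.next_mem hp).1).1
        intro y hy
        obtain ⟨x, hx, rfl⟩ := List.mem_map.1 hy
        exact hfeas x hx
      obtain ⟨L', N', hupd, hr'⟩ := hr.step hp ht hxa hnext
      refine ⟨_, _, ?_, hcσ, ?_, L', N', hr', rfl⟩
      · simp [Enc.enc, hp]
      · rw [← hupd]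
        have hid : (Prog.prim .id).RunsWithin (Enc.enc σ) (Enc.enc σ) _ := .prim rfl
        refine ((hPu (σ, encVec x, (Pb.milp I).ratImage x)).comp
          (hid.pair (hcallx.comp hqσ))).mono ?_
        have h1 := pq.eval_le_eval_nat hσZ
        have h2 : pu.eval (encSize (σ, encVec x, (Pb.milp I).ratImage x)) ≤
            pu.eval (2 + Z s + a s + g s) := by
          refine pu.eval_le_eval_nat ?_
          have hxa' : encSize (encVec x) ≤ a s := hxa
          rw [encSize_mk σ, encSize_mk (encVec x)]
          omega
        have h3 : (Enc.enc σ).size ≤ Z s := hσZ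
        simp only [T]
        omega
  -- the first solution
  have hfσ := hPf (I, b, c)
  have hz₀' : encSize (I, b, c) ≤ z₀ s := by
    have hI' : encSize I ≤ a s := hsize.1
    rw [encSize_mk]
    simp only [z₀]
    omega
  obtain ⟨x, t, ht, hxX, hxa, hxg, hcallx⟩ := hcall 0 (fun s => pf.eval (z₀ s)) le_rfl
    (hfσ.size_le.trans (pf.eval_le_eval_nat hz₀'))
  have hr₀ : Represents Pb WS I b c (a s) (e s) 0 [x] [] := by
    refine ⟨?_, rfl, by simpa using hxa, by simp, by simp⟩
    have h1 : {y | y ∈ [x]} = {x} := by ext; simp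
    have h2 : {u : Fin (d + 1) → ℚ | u ∈ []} = ∅ := by ext; simp
    rw [h1, h2, Set.image_empty]
    exact .init hxX
  have hstart' : start.RunsWithin (Enc.enc (I, b, c)) (Enc.enc (algState Pb I b c [x] []))
      (T₀ s) := by
    have hid : (Prog.prim .id).RunsWithin (Enc.enc (I, b, c)) (Enc.enc (I, b, c)) _ := .prim rfl
    refine ((hPi ((I, b, c), encVec x, (Pb.milp I).ratImage x)).comp
      (hid.pair (hcallx.comp hfσ))).mono ?_
    have h1 := pf.eval_le_eval_nat hz₀'
    have h2 : pi.eval (encSize ((I, b, c), encVec x, (Pb.milp I).ratImage x)) ≤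
        pi.eval (2 + z₀ s + a s + g s) := by
      refine pi.eval_le_eval_nat ?_
      have hxa' : encSize (encVec x) ≤ a s := hxa
      rw [encSize_mk, encSize_mk (encVec x)]
      omega
    have h3 : (Enc.enc (I, b, c)).size ≤ z₀ s := hz₀'
    simp only [T₀]
    omega
  have hparams' : params.RunsWithin (.pair I (.num s.2)) (Enc.enc (I, b, c)) (7 * a s + 10) := by
    have h1 : (Prog.prim .fst).RunsWithin (.pair I (.num s.2)) I _ := .prim rfl
    have h2 : (Prog.prim .snd).RunsWithin (.pair I (.num s.2)) (.num s.2) _ := .prim rfl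
    refine (h1.pair (hsplit.comp h2)).mono ?_
    have h3 : (Val.num s.2).size ≤ a s := hsize.2
    have h4 := hsize.1
    simp only [Val.size] at h3 ⊢
    simp only [a] at h3 ⊢
    omega
  obtain ⟨k, w, ⟨L, N, hr, hp, rfl⟩, hloop⟩ := Prog.RunsWithin.loop (Inv := Inv) (Done := Done)
    (K := K s) (fun k v ⟨L, N, hr, _⟩ => hInvK k L N hr) hstep ⟨[x], [], hr₀, rfl⟩
  refine ⟨L, ?_, hr.innerOutput hp⟩
  have hout := hPo (algState Pb I b c L N)
  have hL : encVecs L = Enc.enc ((algState Pb I b c L N).2.1.map Prod.fst) := by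
    simp only [algState, encVecs, Enc.enc, List.map_map]
    rfl
  rw [hL]
  refine (hout.comp (hloop.comp (hstart'.comp hparams'))).mono (le_trans ?_ (hq s hs))
  have := po.eval_le_eval_nat (hInvZ hr)
  dsimp only
  omega

end Execution

/-! ### Approximation schemes -/

/-- The choice `β = γ = ε / (2 + ε)`. -/
theorem exists_isPolySplit : ∃ β γ : ℚ → ℚ, IsPolySplit β γ := by
  have hβ : PolyTime (fun ε : ℚ => ε * (2 + ε)⁻¹) := .mul .id (.inv (.add (.const 2) .id))
  obtain ⟨S, p, hS⟩ := hβ.prodMk hβ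
  refine ⟨fun ε => ε * (2 + ε)⁻¹, fun ε => ε * (2 + ε)⁻¹, fun ε hε => ⟨by positivity,
    by positivity, ?_⟩, S, p + (2 * .X + 1), fun ε hε => ?_⟩
  · have h : 1 + ε - (1 + ε * (2 + ε)⁻¹) * (1 + ε * (2 + ε)⁻¹) =
        (1 + ε) * (ε * (2 + ε)⁻¹) ^ 2 := by
      field_simp
      ring
    have : 0 ≤ (1 + ε) * (ε * (2 + ε)⁻¹) ^ 2 := by positivity
    linarith
  · have hinv : ⌈(ε * (2 + ε)⁻¹)⁻¹⌉₊ ≤ (p + (2 * .X + 1)).eval ⌈ε⁻¹⌉₊ := by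
      rw [Nat.ceil_le]
      have h1 : (ε * (2 + ε)⁻¹)⁻¹ = 2 * ε⁻¹ + 1 := by field_simp
      have h2 := Nat.le_ceil ε⁻¹
      rw [h1]
      simp only [Polynomial.eval_add, Polynomial.eval_mul, Polynomial.eval_X,
        Polynomial.eval_one, Polynomial.eval_ofNat]
      push_cast
      have h3 : (0 : ℚ) ≤ (p.eval ⌈ε⁻¹⌉₊ : ℕ) := Nat.cast_nonneg _
      linarith
    refine ⟨?_, hinv, hinv⟩
    obtain ⟨t, ht, htp⟩ := hS ε
    refine ⟨t, ht, htp.trans ?_⟩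
    rw [Polynomial.eval_add]
    exact Nat.le_add_right _ _

theorem Problem.exists_evaluates {d : ℕ} (Pb : Problem d) :
    ∃ (E : Prog) (p : Polynomial ℕ), Evaluates Pb E p := by
  obtain ⟨E, p, h⟩ := Pb.evaluable
  exact ⟨E, p, fun I hI x hx => h I hI x hx⟩

section Schemes

variable {d : ℕ} {Pb : Problem d} {WS S : Prog} {β γ : ℚ → ℚ}

/-- For a fixed accuracy, all quantities that depend on the accuracy only are constants. -/
theorem exists_isRegime_of_isWSPTAS (hWS : IsWSPTAS Pb WS) (hshort : HasShortSolutions Pb WS)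
    (hs : IsSplit β γ)
    (hS : ∀ ε : ℚ, 0 < ε → ∃ t, Runs S (.num ε) (.pair (.num (β ε)) (.num (γ ε))) t)
    {ε : ℚ} (hε : 0 < ε) :
    ∃ p, IsRegime Pb WS S β γ {s | s.1 ∈ Pb.inst ∧ s.2 = ε} (fun s => s.1.size) p := by
  obtain ⟨hβ, hγ, -⟩ := hs ε hε
  obtain ⟨p, hp⟩ := hWS _ hβ
  obtain ⟨q, hq⟩ := hshort _ hβ
  obtain ⟨t, ht⟩ := hS ε hε
  refine ⟨.X + .C (encSize ε + ⌈(γ ε)⁻¹⌉₊ + t) + p + q, ?_, ?_, ?_, ?_, ?_, ?_⟩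
  · exact fun s hs => hs.1
  · rintro ⟨I, ε'⟩ ⟨hI, rfl⟩
    exact hγ
  · rintro ⟨I, ε'⟩ ⟨hI, rfl⟩
    simp only [Polynomial.eval_add, Polynomial.eval_X, Polynomial.eval_C]
    omega
  · rintro ⟨I, ε'⟩ ⟨hI, rfl⟩
    simp only [Polynomial.eval_add, Polynomial.eval_X, Polynomial.eval_C]
    omega
  · rintro ⟨I, ε'⟩ ⟨hI, rfl⟩
    refine ⟨t, ht, ?_⟩
    simp only [Polynomial.eval_add, Polynomial.eval_X, Polynomial.eval_C]
    omega
  · rintro ⟨I, ε'⟩ ⟨hI, rfl⟩ w hw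
    obtain ⟨x, t', hrun, happ, ht'⟩ := hp I hI w hw
    have hx := hq I hI w hw x t' hrun
    refine ⟨x, ⟨t', hrun, ?_⟩, happ, ?_⟩
    · simp only [Polynomial.eval_add]
      omega
    · simp only [Polynomial.eval_add]
      omega

/-- For fully polynomial schemes, one polynomial in the lengths of the instance and of the accuracy
and in the inverse accuracy bounds everything. -/
theorem exists_isRegime_of_isWSFPTAS (hWS : IsWSFPTAS Pb WS)
    (hshort : HasUniformlyShortSolutions Pb WS) (hs : IsSplit β γ) {r : Polynomial ℕ}
    (hS : ∀ ε : ℚ, 0 < ε →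
      (∃ t, Runs S (.num ε) (.pair (.num (β ε)) (.num (γ ε))) t ∧ t ≤ r.eval (Val.num ε).size) ∧
        ⌈(β ε)⁻¹⌉₊ ≤ r.eval ⌈ε⁻¹⌉₊ ∧ ⌈(γ ε)⁻¹⌉₊ ≤ r.eval ⌈ε⁻¹⌉₊) :
    ∃ p, IsRegime Pb WS S β γ {s | s.1 ∈ Pb.inst ∧ 0 < s.2}
      (fun s => s.1.size + (Val.num s.2).size + ⌈s.2⁻¹⌉₊) p := by
  obtain ⟨p, hp⟩ := hWS
  obtain ⟨q, hq⟩ := hshort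
  refine ⟨.X + r + p.comp (.X + r + r) + q.comp (.X + r + r), ?_, ?_, ?_, ?_, ?_, ?_⟩
  · exact fun s hs => hs.1
  · rintro ⟨I, ε⟩ ⟨-, hε⟩
    exact (hs ε hε).2.1
  · rintro ⟨I, ε⟩ -
    have : encSize ε = (Val.num ε).size := rfl
    simp only [Polynomial.eval_add, Polynomial.eval_X]
    omega
  · rintro ⟨I, ε⟩ ⟨-, hε⟩
    have h1 := (hS ε hε).2.2
    have h2 : r.eval ⌈ε⁻¹⌉₊ ≤ r.eval (I.size + (Val.num ε).size + ⌈ε⁻¹⌉₊) :=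
      r.eval_le_eval_nat (by omega)
    simp only [Polynomial.eval_add, Polynomial.eval_X] at *
    omega
  · rintro ⟨I, ε⟩ ⟨-, hε⟩
    obtain ⟨t, ht, htr⟩ := (hS ε hε).1
    have h2 : r.eval (Val.num ε).size ≤ r.eval (I.size + (Val.num ε).size + ⌈ε⁻¹⌉₊) :=
      r.eval_le_eval_nat (by omega)
    refine ⟨t, ht, ?_⟩
    simp only [Polynomial.eval_add, Polynomial.eval_X] at *
    omega
  · rintro ⟨I, ε⟩ ⟨hI, hε⟩ w hw
    dsimp only at hI hε ⊢
    obtain ⟨⟨t, ht, htr⟩, hβr, -⟩ := hS ε hε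
    obtain ⟨x, t', hrun, happ, ht'⟩ := hp _ (hs ε hε).1 I hI w hw
    have hx := hq _ (hs ε hε).1 I hI w hw x t' hrun
    have hsize : (Val.num (β ε)).size ≤ r.eval (Val.num ε).size := by
      have := ht.size_le.2
      simp only [Val.size] at this htr ⊢
      omega
    set n := I.size + (Val.num ε).size + ⌈ε⁻¹⌉₊ with hn
    set l := (encVec w).size
    have h1 : r.eval (Val.num ε).size ≤ r.eval n := r.eval_le_eval_nat (by omega)
    have h2 : r.eval ⌈ε⁻¹⌉₊ ≤ r.eval n := r.eval_le_eval_nat (by omega)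
    have h3 : r.eval n ≤ r.eval (n + l) := r.eval_le_eval_nat (by omega)
    refine ⟨x, ⟨t', hrun, ?_⟩, happ, ?_⟩
    · have h4 : p.eval (I.size + l + (Val.num (β ε)).size + ⌈(β ε)⁻¹⌉₊) ≤
          p.eval (n + l + r.eval (n + l) + r.eval (n + l)) := p.eval_le_eval_nat (by omega)
      simp only [Polynomial.eval_add, Polynomial.eval_comp, Polynomial.eval_X]
      omega
    · have h4 : q.eval (I.size + (Val.num (β ε)).size + ⌈(β ε)⁻¹⌉₊) ≤
          q.eval (n + r.eval n + r.eval n) := q.eval_le_eval_nat (by omega)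
      simp only [Polynomial.eval_add, Polynomial.eval_comp, Polynomial.eval_X]
      omega

end Schemes

theorem theorem4p4 (d : ℕ) (hd : 0 < d) (Pb : Problem d) (WS : Prog) :
    (∃ β γ : ℚ → ℚ, IsPolySplit β γ) ∧
    (IsWSPTAS Pb WS → HasShortSolutions Pb WS →
      ∀ β γ : ℚ → ℚ, IsComputableSplit β γ →
        AlwaysCorrect Pb WS β γ ∧ AlwaysPolyIter Pb WS β γ ∧
        ∃ P : Prog, Implements Pb WS β γ P ∧ IsConvexPTAS Pb P) ∧
    (IsWSFPTAS Pb WS → HasUniformlyShortSolutions Pb WS →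
      ∀ β γ : ℚ → ℚ, IsPolySplit β γ →
        AlwaysCorrect Pb WS β γ ∧ AlwaysUniformPolyIter Pb WS β γ ∧
        ∃ P : Prog, Implements Pb WS β γ P ∧ IsConvexFPTAS Pb P) := by
  obtain ⟨E, pE, hE⟩ := Pb.exists_evaluates
  refine ⟨exists_isPolySplit, ?_, ?_⟩
  · rintro hWS hshort β γ ⟨hs, S, hS⟩
    have hcorrect : AlwaysCorrect Pb WS β γ := by
      refine alwaysCorrect_of_isApproxWS hs fun δ hδ I hI w hw => ?_
      obtain ⟨p, hp⟩ := hWS δ hδ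
      obtain ⟨x, t, h1, h2, -⟩ := hp I hI w hw
      exact ⟨x, t, h1, h2⟩
    obtain ⟨P, hP⟩ := exists_program Pb WS S E hE
    refine ⟨hcorrect, fun ε hε => ?_, P, fun ε hε I hI => ?_, fun ε hε => ?_⟩
    · obtain ⟨p, hp⟩ := exists_isRegime_of_isWSPTAS hWS hshort hs hS hε
      obtain ⟨q, hq⟩ := hp.polyBounded_iterBound (pE := pE)
      exact ⟨q, fun I hI k R F hrun => (hp.le_iterBound hE (s := (I, ε)) ⟨hI, rfl⟩ hrun).trans
        (hq (I, ε) ⟨hI, rfl⟩)⟩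
    · obtain ⟨p, hp⟩ := exists_isRegime_of_isWSPTAS hWS hshort hs hS hε
      obtain ⟨q, hq⟩ := hP β γ _ _ p hp
      obtain ⟨L, ⟨t, ht, -⟩, hout⟩ := hq (I, ε) ⟨hI, rfl⟩
      exact ⟨L, t, ht, hout⟩
    · obtain ⟨p, hp⟩ := exists_isRegime_of_isWSPTAS hWS hshort hs hS hε
      obtain ⟨q, hq⟩ := hP β γ _ _ p hp
      refine ⟨q, fun I hI => ?_⟩
      obtain ⟨L, ⟨t, ht, htq⟩, hout⟩ := hq (I, ε) ⟨hI, rfl⟩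
      exact ⟨L, t, ht, hcorrect ε hε I hI _ hout, htq⟩
  · rintro hWS hshort β γ ⟨hs, S, r, hS⟩
    have hcorrect : AlwaysCorrect Pb WS β γ := by
      refine alwaysCorrect_of_isApproxWS hs fun δ hδ I hI w hw => ?_
      obtain ⟨p, hp⟩ := hWS
      obtain ⟨x, t, h1, h2, -⟩ := hp δ hδ I hI w hw
      exact ⟨x, t, h1, h2⟩
    obtain ⟨P, hP⟩ := exists_program Pb WS S E hE
    obtain ⟨p, hp⟩ := exists_isRegime_of_isWSFPTAS hWS hshort hs hS
    obtain ⟨q', hq'⟩ := hp.polyBounded_iterBound (pE := pE)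
    obtain ⟨q, hq⟩ := hP β γ _ _ p hp
    refine ⟨hcorrect, ⟨q', fun ε hε I hI k R F hrun => ?_⟩, P, fun ε hε I hI => ?_,
      q, fun ε hε I hI => ?_⟩
    · exact (hp.le_iterBound hE (s := (I, ε)) ⟨hI, hε⟩ hrun).trans (hq' (I, ε) ⟨hI, hε⟩)
    · obtain ⟨L, ⟨t, ht, -⟩, hout⟩ := hq (I, ε) ⟨hI, hε⟩
      exact ⟨L, t, ht, hout⟩
    · obtain ⟨L, ⟨t, ht, htq⟩, hout⟩ := hq (I, ε) ⟨hI, hε⟩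
      exact ⟨L, t, ht, hcorrect ε hε I hI _ hout, htq⟩
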